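/- **Setting.** A graph has a set of vertices and a set of directed edges; each directed edge $e$ has an origin $o(e)$, a terminus $t(e)$ and an inverse $\bar e\neq e$ with $\bar{\bar e}=e$, $o(\bar e)=t(e)$; loops and multiple edges are allowed. A $d$-dimensional topological crystal ($d\ge 1$) is a connected regular covering graph $X=(V,E)$ of a finite connected graph $X_0=(V_0,E_0)$ whose covering transformation group $L$ is free abelian of rank $d$. All vertex degrees $|\{e : o(e)=x\}|$ are assumed to be at least $3$. A periodic realization of $X$ is a map $\Phi:X\to\mathbb R^d$ on the 1-dimensional cell complex $X$, affine on each edge, such that $\Phi(\sigma x)=\Phi(x)+\rho(\sigma)$ for $\sigma\in L$, where $\rho:L\to\mathbb R^d$ is an injective homomorphism whose image (the period lattice) is a lattice in $\mathbb R^d$. The vectors $\Phi(t(e))-\Phi(o(e))$ depend only on the image of $e$ in $E_0$; this defines the building cochain $\mathbf v:E_0\to\mathbb R^d$. Give $C_1(X_0,\mathbb R)$ (where $\bar e=-e$) the inner product for which the edges of an orientation are an orthonormal basis. Let $H\subset H_1(X_0,\mathbb Z)$ be the kernel of the canonical map $H_1(X_0,\mathbb Z)\to L$ (equivalently, the image of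 $H_1(X,\mathbb Z)$ under the covering map), $H_{\mathbb R}\subset H_1(X_0,\mathbb R)$ its real span, and $H_{\mathbb R}^\perp$ the orthogonal complement of $H_{\mathbb R}$ in $H_1(X_0,\mathbb R)$, of dimension $d$. Let $P_0:C_1(X_0,\mathbb R)\to H_1(X_0,\mathbb R)$ and $P:H_1(X_0,\mathbb R)\to H_{\mathbb R}^\perp$ be the orthogonal projections. A realization is a *normalized standard realization* if, after $H_{\mathbb R}^\perp$ is identified with $\mathbb R^d$ by an orthonormal basis, its building cochain is $e\mapsto P(P_0(e))$; a *standard realization* is the composition of a normalized one with a similarity of $\mathbb R^d$. **Theorem.** Let $\Phi:X\to\mathbb R^d$ be an injective periodic realization of a $d$-dimensional topological crystal $X$ over $X_0$ (injective on the whole cell complex, so that distinct vertices have distinct images and edges do not overlap or cross). Let $\Gamma$ be a group of congruence transformations of $\mathbb R^d$ that preserves the set $\Phi(X)$ and contains the translations by the period lattice. Let $K\subset O(d)$ be its point group, i.e. the group of linear parts of elements of $\Gamma$, and for $p\in\mathbb R^d$ let $\Gamma_p=\{g\in\Gamma : g(p)=p\}$, which acts on $\mathbb R^d$ through linear parts.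 Suppose that 1. $K$ acts irreducibly on $\mathbb R^d$, and 2. for every vertex $x\in V$, the only vector of $\mathbb R^d$ fixed by the linear parts of all elements of $\Gamma_{\Phi(x)}$ is $\mathbf 0$. Then $\Phi$ is a standard realization. Moreover, its building vectors $\{\mathbf v(e)\}_{e\in E_0}$ form a tight frame, i.e. they span $\mathbb R^d$ and there is $\alpha>0$ with $\sum_{e\in E_0}\langle \mathbf x,\mathbf v(e)\rangle\,\mathbf v(e)=\alpha\mathbf x$ for all $\mathbf x\in\mathbb R^d$, and they are harmonic: $\sum_{e\in E_0,\ o(e)=x}\mathbf v(e)=\mathbf 0$ for every $x\in V_0$. -/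

import Mathlib

namespace TopCrystal

/-- A graph given by its directed edges, with loops and multiple edges allowed.
Every edge occurs with its two directions `e` and `inv e`, which are distinct. -/
structure DirGraph (V E : Type*) where
  /-- origin -/
  o : E → V
  /-- terminus -/
  t : E → V
  /-- inversion of directed edges -/
  inv : E → E
  inv_inv : ∀ e, inv (inv e) = e
  inv_ne : ∀ e, inv e ≠ e
  o_inv : ∀ e, o (inv e) = t e

namespace DirGraph

variable {V E : Type*}

theorem t_inv (X : DirGraph V E) (e : E) : X.t (X.inv e) = X.o e := by
  rw [← X.o_inv, X.inv_inv]

/-- Nonempty, and any two vertices are joined by a path of directed edges. -/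
def Connected (X : DirGraph V E) : Prop :=
  Nonempty V ∧
    ∀ x y : V, Relation.ReflTransGen (fun a b => ∃ e, X.o e = a ∧ X.t e = b) x y

/-- The degree of a vertex: the number of directed edges with origin `x`. -/
noncomputable def degree (X : DirGraph V E) (x : V) : ℕ := Nat.card {e : E // X.o e = x}

/-! ### The graph as a one-dimensional cell complex -/

/-- The gluing that builds the one-dimensional cell complex of a graph from its vertices and
from one unit interval for each directed edge: the interval of `e` starts at the origin of `e`,
and the interval of `inv e` is that of `e` run backwards. -/
inductive Glue (X : DirGraph V E) : V ⊕ E × unitInterval → V ⊕ E × unitInterval → Prop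
  | origin (e : E) : Glue X (Sum.inr (e, 0)) (Sum.inl (X.o e))
  | reverse (e : E) (s : unitInterval) :
      Glue X (Sum.inr (e, s)) (Sum.inr (X.inv e, unitInterval.symm s))

/-- The set of points of the one-dimensional cell complex of a graph. -/
def Space (X : DirGraph V E) : Type _ := Quot X.Glue

/-- The piecewise linear map on the cell complex of `X` that is given by `Φ` on the vertices
and is affine on each edge. -/
noncomputable def plMap {F : Type*} [AddCommGroup F] [Module ℝ F]
    (X : DirGraph V E) (Φ : V → F) : X.Space → F :=
  Quot.lift
    (Sum.elim Φ fun p => AffineMap.lineMap (Φ (X.o p.1)) (Φ (X.t p.1)) (p.2 : ℝ))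
    (by
      intro a b h
      cases h with
      | origin e => simp
      | reverse e s =>
        simp [X.o_inv, X.t_inv, AffineMap.lineMap_apply_one_sub])

/-! ### Chains and homology -/

/-- The group `C₁(X, K)` of 1-chains, in which `inv e = -e`: finitely supported functions on
directed edges that are odd under inversion. -/
def chains (K : Type*) [CommRing K] (X : DirGraph V E) : Submodule K (E →₀ K) where
  carrier := {c | ∀ e, c (X.inv e) = -c e}
  add_mem' := by
    intro a b ha hb e
    simp only [Finsupp.add_apply, ha e, hb e]
    ring
  zero_mem' := by intro e; simp
  smul_mem' := by
    intro k a ha e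
    simp [ha e]

/-- The 1-chain of a directed edge. -/
noncomputable def edgeChain (K : Type*) [CommRing K] (X : DirGraph V E) (e : E) :
    X.chains K :=
  ⟨Finsupp.single e 1 - Finsupp.single (X.inv e) 1, by
    classical
    intro f
    have h1 : X.inv e = X.inv f ↔ e = f :=
      ⟨fun h => by rw [← X.inv_inv e, h, X.inv_inv], fun h => by rw [h]⟩
    have h2 : e = X.inv f ↔ X.inv e = f :=
      ⟨fun h => by rw [h, X.inv_inv], fun h => by rw [← h, X.inv_inv]⟩
    simp only [Finsupp.sub_apply, Finsupp.single_apply, h1, h2]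
    ring⟩

/-- The boundary operator `∂ : C₁(X, K) → C₀(X, K)`. The value of `∂ c` at `x` is the sum of
`c e` over the directed edges `e` with terminus `x`. -/
noncomputable def boundary (K : Type*) [CommRing K] (X : DirGraph V E) :
    X.chains K →ₗ[K] (V →₀ K) :=
  (Finsupp.lmapDomain K K X.t).comp (X.chains K).subtype

/-- The boundary of a directed edge is its terminus minus its origin. -/
theorem boundary_edgeChain (K : Type*) [CommRing K] (X : DirGraph V E) (e : E) :
    X.boundary K (X.edgeChain K e) = Finsupp.single (X.t e) 1 - Finsupp.single (X.o e) 1 := by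
  simp [boundary, edgeChain, Finsupp.mapDomain_sub, Finsupp.mapDomain_single, X.t_inv]

/-- The first homology group `H₁(X, K) = ker ∂`. -/
noncomputable def H1 (K : Type*) [CommRing K] (X : DirGraph V E) : Submodule K (X.chains K) :=
  LinearMap.ker (X.boundary K)

/-- The inner product on `C₁(X, ℝ)` of a finite graph for which the directed edges of any
orientation form an orthonormal basis. Every edge is counted with both of its directions,
whence the factor `1 / 2`. -/
noncomputable instance chainsCore [Fintype E] (X : DirGraph V E) :
    InnerProductSpace.Core ℝ (X.chains ℝ) where
  inner a b := (1 / 2) * ∑ e, a.1 e * b.1 e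
  conj_inner_symm a b := by simp [mul_comm]
  re_inner_nonneg a := by
    have : 0 ≤ ∑ e, a.1 e * a.1 e := Finset.sum_nonneg fun e _ => mul_self_nonneg _
    simpa using this
  add_left a b c := by
    simp [add_mul, Finset.sum_add_distrib, mul_add]
  smul_left a b r := by
    simp only [Submodule.coe_smul, Finsupp.smul_apply, smul_eq_mul, mul_assoc,
      ← Finset.mul_sum, conj_trivial]
    ring
  definite a h := by
    have h' : ∑ e, a.1 e * a.1 e = 0 := by
      have : (1 / 2 : ℝ) * ∑ e, a.1 e * a.1 e = 0 := h
      linarith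
    rw [Finset.sum_eq_zero_iff_of_nonneg fun e _ => mul_self_nonneg _] at h'
    ext e
    exact mul_self_eq_zero.mp (h' e (Finset.mem_univ e))

noncomputable instance chainsNormedAddCommGroup [Fintype E] (X : DirGraph V E) :
    NormedAddCommGroup (X.chains ℝ) :=
  (X.chainsCore).toNormedAddCommGroup

noncomputable instance chainsInnerProductSpace [Fintype E] (X : DirGraph V E) :
    InnerProductSpace ℝ (X.chains ℝ) :=
  InnerProductSpace.ofCore (X.chainsCore).toCore

/-- The inner product of a directed edge with a 1-chain is the coefficient of the edge. In
particular `⟨e, e⟩ = 1`, `⟨e, inv e⟩ = -1`, and `⟨e, f⟩ = 0` for all other directed edges `f`. -/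
theorem inner_edgeChain_left [Fintype E] (X : DirGraph V E) (e : E) (c : X.chains ℝ) :
    inner ℝ (X.edgeChain ℝ e) c = c.1 e := by
  classical
  have hdef : inner ℝ (X.edgeChain ℝ e) c =
      (1 / 2) * ∑ g, (X.edgeChain ℝ e).1 g * c.1 g := rfl
  have hc : c.1 (X.inv e) = -c.1 e := c.2 e
  rw [hdef]
  simp only [edgeChain, Finsupp.sub_apply, Finsupp.single_apply, sub_mul,
    Finset.sum_sub_distrib, ite_mul, one_mul, zero_mul,
    Finset.sum_ite_eq, Finset.mem_univ, if_true, hc]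
  ring

end DirGraph

/-! ### Topological crystals -/

section Crystal

variable {V E V₀ E₀ : Type*}

/-- `X` is a `d`-dimensional topological crystal over the finite graph `X₀`: a connected,
infinite-fold, regular covering graph `(pV, pE) : X → X₀` whose covering transformation group
is the free abelian group `L` of rank `d`. Since `X` is connected and `L` acts simply
transitively on the fibers, `L` is the whole group of covering transformations. -/
structure IsTopologicalCrystal (d : ℕ) (L : Type*) [AddCommGroup L] [AddAction L V]
    [AddAction L E] (X : DirGraph V E) (X₀ : DirGraph V₀ E₀) (pV : V → V₀) (pE : E → E₀) :
    Prop where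
  finite_vertices : Finite V₀
  finite_edges : Finite E₀
  connected_base : X₀.Connected
  connected : X.Connected
  /-- `(pV, pE)` is a morphism of graphs -/
  map_o : ∀ e, X₀.o (pE e) = pV (X.o e)
  map_t : ∀ e, X₀.t (pE e) = pV (X.t e)
  map_inv : ∀ e, pE (X.inv e) = X₀.inv (pE e)
  /-- it is surjective on vertices, and bijective on the edges that start at a vertex -/
  surjective : Function.Surjective pV
  lift_edge : ∀ (x : V) (e₀ : E₀), X₀.o e₀ = pV x → ∃! e : E, X.o e = x ∧ pE e = e₀
  /-- `L` acts by automorphisms of the graph `X` -/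
  vadd_o : ∀ (σ : L) (e : E), X.o (σ +ᵥ e) = σ +ᵥ X.o e
  vadd_t : ∀ (σ : L) (e : E), X.t (σ +ᵥ e) = σ +ᵥ X.t e
  vadd_inv : ∀ (σ : L) (e : E), X.inv (σ +ᵥ e) = σ +ᵥ X.inv e
  /-- these automorphisms are covering transformations -/
  map_vadd_vertex : ∀ (σ : L) (x : V), pV (σ +ᵥ x) = pV x
  map_vadd_edge : ∀ (σ : L) (e : E), pE (σ +ᵥ e) = pE e
  /-- `L` acts simply transitively on each fiber -/
  simply_transitive : ∀ x y : V, pV x = pV y → ∃! σ : L, σ +ᵥ x = y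
  /-- `L` is free abelian of rank `d`, and infinite -/
  free : Module.Free ℤ L
  finitely_generated : Module.Finite ℤ L
  rank_eq : Module.finrank ℤ L = d
  infinite_fold : 0 < d

/-- The map `Φ` on the vertices (extended affinely to the edges) is a periodic realization of
`X` with period homomorphism `ρ`: it is equivariant, and `ρ` is injective with image a lattice,
that is, a discrete subgroup that spans the space. -/
structure IsPeriodicRealization {d : ℕ} {L : Type*} [AddCommGroup L] [AddAction L V]
    (Φ : V → EuclideanSpace ℝ (Fin d)) (ρ : L →+ EuclideanSpace ℝ (Fin d)) : Prop where
  equivariant : ∀ (σ : L) (x : V), Φ (σ +ᵥ x) = Φ x + ρ σ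
  injective : Function.Injective ρ
  discrete : DiscreteTopology ρ.range
  span_eq_top : Submodule.span ℝ (Set.range ρ) = ⊤

/-- `v` is the building cochain of `Φ`, seen as a function on the directed edges of `X₀`. -/
def IsBuildingCochain {d : ℕ} (X : DirGraph V E) (pE : E → E₀)
    (Φ : V → EuclideanSpace ℝ (Fin d)) (v : E₀ → EuclideanSpace ℝ (Fin d)) : Prop :=
  ∀ e : E, v (pE e) = Φ (X.t e) - Φ (X.o e)

/-! ### Standard realizations -/

/-- The subspace `H_ℝ` of `H₁(X₀, ℝ)` spanned by the vanishing subgroup `H`. The vanishing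
subgroup is the kernel of the canonical map `H₁(X₀, ℤ) → L`; by the theory of covering spaces
this is the image of `H₁(X, ℤ)` in `H₁(X₀, ℤ)` under the covering map. -/
noncomputable def vanishingSpace (X : DirGraph V E) (X₀ : DirGraph V₀ E₀) (pE : E → E₀) :
    Submodule ℝ (X₀.chains ℝ) :=
  Submodule.span ℝ {c | ∃ z ∈ X.H1 ℤ, ∀ e₀ : E₀,
    c.1 e₀ = ((Finsupp.mapDomain pE z.1 e₀ : ℤ) : ℝ)}

/-- The orthogonal complement of `H_ℝ` in `H₁(X₀, ℝ)`. -/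
noncomputable def vanishingSpacePerp [Fintype E₀] (X : DirGraph V E) (X₀ : DirGraph V₀ E₀)
    (pE : E → E₀) : Submodule ℝ (X₀.chains ℝ) :=
  X₀.H1 ℝ ⊓ (vanishingSpace X X₀ pE)ᗮ

/-- `v₀(e)`, the orthogonal projection of the directed edge `e` to `H₁(X₀, ℝ)`. -/
noncomputable def harmonicEdge [Fintype E₀] (X₀ : DirGraph V₀ E₀) (e : E₀) : X₀.H1 ℝ :=
  (X₀.H1 ℝ).orthogonalProjectionOnto (X₀.edgeChain ℝ e)

/-- The building cochain `P(v₀(e))` of the normalized standard realization, where `P` is the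
orthogonal projection of `H₁(X₀, ℝ)` to the orthogonal complement of `H_ℝ`. -/
noncomputable def standardCochain [Fintype E₀] (X : DirGraph V E) (X₀ : DirGraph V₀ E₀)
    (pE : E → E₀) (e : E₀) : vanishingSpacePerp X X₀ pE :=
  (vanishingSpacePerp X X₀ pE).orthogonalProjectionOnto (harmonicEdge X₀ e : X₀.chains ℝ)

/-- `Φ` is a normalized standard realization: its building cochain is `P(v₀(e))`, the orthogonal
complement of `H_ℝ` being identified with `ℝᵈ` through an orthonormal basis. -/
def IsNormalizedStandardRealization {d : ℕ} [Fintype E₀] (X : DirGraph V E)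
    (X₀ : DirGraph V₀ E₀) (pE : E → E₀) (Φ : V → EuclideanSpace ℝ (Fin d)) : Prop :=
  ∃ ι : vanishingSpacePerp X X₀ pE ≃ₗᵢ[ℝ] EuclideanSpace ℝ (Fin d),
    IsBuildingCochain X pE Φ fun e => ι (standardCochain X X₀ pE e)

/-- `Φ` is a standard realization: it is obtained from a normalized standard realization by a
similarity of `ℝᵈ`. -/
def IsStandardRealization {d : ℕ} [Fintype E₀] (X : DirGraph V E)
    (X₀ : DirGraph V₀ E₀) (pE : E → E₀) (Φ : V → EuclideanSpace ℝ (Fin d)) : Prop :=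
  ∃ Φ₀ : V → EuclideanSpace ℝ (Fin d), IsNormalizedStandardRealization X X₀ pE Φ₀ ∧
    ∃ (r : ℝ) (U : EuclideanSpace ℝ (Fin d) ≃ₗᵢ[ℝ] EuclideanSpace ℝ (Fin d))
      (b : EuclideanSpace ℝ (Fin d)), 0 < r ∧ ∀ x, Φ x = r • U (Φ₀ x) + b

/-- A finite family of vectors is a tight frame: it generates the space, and its frame operator
is a positive multiple of the identity. -/
def IsTightFrame {d : ℕ} {I : Type*} [Fintype I] (v : I → EuclideanSpace ℝ (Fin d)) : Prop :=
  Submodule.span ℝ (Set.range v) = ⊤ ∧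
    ∃ α : ℝ, 0 < α ∧ ∀ x : EuclideanSpace ℝ (Fin d), ∑ i, inner ℝ x (v i) • v i = α • x

open Classical in
/-- At every vertex the sum of the values of the cochain on the edges starting there is zero. -/
def IsHarmonic {d : ℕ} [Fintype E₀] (X₀ : DirGraph V₀ E₀)
    (v : E₀ → EuclideanSpace ℝ (Fin d)) : Prop :=
  ∀ x : V₀, ∑ e with X₀.o e = x, v e = 0

end Crystal

/-! ### Groups of congruence transformations -/

section Congruence

variable {F : Type*} [NormedAddCommGroup F] [InnerProductSpace ℝ F]

/-- The homomorphism that maps a congruence transformation to its linear part. -/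
noncomputable def linearPart : (F ≃ᵃⁱ[ℝ] F) →* (F ≃ₗᵢ[ℝ] F) where
  toFun g := g.linearIsometryEquiv
  map_one' := by ext v; rfl
  map_mul' g h := by ext v; rfl

/-- The point group of a group of congruence transformations. -/
noncomputable def pointGroup (Γ : Subgroup (F ≃ᵃⁱ[ℝ] F)) : Subgroup (F ≃ₗᵢ[ℝ] F) := Γ.map linearPart

/-- The isotropy group `Γ_p` of a point. -/
def isotropyGroup (Γ : Subgroup (F ≃ᵃⁱ[ℝ] F)) (p : F) : Subgroup (F ≃ᵃⁱ[ℝ] F) where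
  carrier := {g | g ∈ Γ ∧ g p = p}
  one_mem' := ⟨Γ.one_mem, rfl⟩
  mul_mem' := by
    rintro g h ⟨hg, hgp⟩ ⟨hh, hhp⟩
    refine ⟨Γ.mul_mem hg hh, ?_⟩
    change g (h p) = p
    rw [hhp, hgp]
  inv_mem' := by
    rintro g ⟨hg, hgp⟩
    refine ⟨Γ.inv_mem hg, ?_⟩
    change g.symm p = p
    rw [AffineIsometryEquiv.symm_apply_eq, hgp]

/-- A group of orthogonal transformations acts irreducibly. -/
def ActsIrreducibly (K : Subgroup (F ≃ₗᵢ[ℝ] F)) : Prop :=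
  Nontrivial F ∧
    ∀ W : Submodule ℝ F, (∀ g ∈ K, ∀ w ∈ W, g w ∈ W) → W = ⊥ ∨ W = ⊤

end Congruence

end TopCrystal

/-! The point set `Φ(X)` remembers the graph. At an interior point of an edge all tangent directions
of `Φ(X)` are parallel, while at a vertex, by injectivity and degree at least 3, some two are not.
Only finitely many edges meet a ball, so tangent directions do come from edges. Hence every element
of `Γ` permutes the vertices and the directed edges (`exists_vertex_map`, `exists_edge_map`).

Harmonicity: the sum of the building vectors at a vertex is fixed by the isotropy group of its
image, hence zero by condition 2.

Tightness: the frame operator is symmetric. Once it commutes with the point group, an eigenspace is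
invariant and irreducibility makes it the whole space. Commutation is not immediate, because an
element of `Γ` need not normalize the period lattice and so need not act on `X₀`. It does normalize
the group of all translations in `Γ`, and a double count of base edges up to these translations
replaces the missing action (`sum_building_comp_linearPart`).

Standardness: send `y` to the chain `e ↦ ⟨y, v e⟩`. It is a cycle by harmonicity, and it is
orthogonal to `H` because it lifts to a coboundary on `X`. This maps `ℝᵈ` onto the orthogonal
complement of `H_ℝ` (`exists_pairingChain_eq`), and tightness makes it a multiple of an isometry.
Its adjoint carries `P(P₀(e))` to `v e`, so `Φ` is standard up to scale. -/

namespace TopCrystal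

namespace DirGraph

variable {V E F : Type*} (X : DirGraph V E)

/-! ### Points of the cell complex -/

open Classical in
/-- The set of all names of a point of the cell complex that are in reduced form: a vertex is
named by itself, an inner point of an edge by its parameters on the two directions. -/
noncomputable def reducedNames : V ⊕ E × unitInterval → Set (V ⊕ E × unitInterval)
  | Sum.inl x => {Sum.inl x}
  | Sum.inr (e, s) =>
    if s = 0 then {Sum.inl (X.o e)} else if s = 1 then {Sum.inl (X.t e)}
    else {Sum.inr (e, s), Sum.inr (X.inv e, unitInterval.symm s)}

theorem reducedNames_eq_of_glue {a b : V ⊕ E × unitInterval} (h : X.Glue a b) :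
    X.reducedNames a = X.reducedNames b := by
  cases h with
  | origin e => simp [reducedNames]
  | reverse e s =>
    by_cases h0 : s = 0
    · subst h0; simp [reducedNames, X.t_inv]
    by_cases h1 : s = 1
    · subst h1; simp [reducedNames, X.o_inv]
    have h2 : unitInterval.symm s ≠ 0 := fun h => h1 (by
      rw [← unitInterval.symm_symm s, h, unitInterval.symm_zero])
    have h3 : unitInterval.symm s ≠ 1 := fun h => h0 (by
      rw [← unitInterval.symm_symm s, h, unitInterval.symm_one])
    simp only [reducedNames, h0, h1, h2, h3, if_false, X.inv_inv, unitInterval.symm_symm]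
    exact Set.pair_comm _ _

/-- `reducedNames` is constant along the gluing and so descends to the quotient; points of the cell
complex can thus be told apart without describing the generated equivalence relation. -/
theorem reducedNames_eq_of_mk_eq {a b : V ⊕ E × unitInterval}
    (h : (Quot.mk X.Glue a : X.Space) = Quot.mk X.Glue b) :
    X.reducedNames a = X.reducedNames b :=
  congrArg (Quot.lift X.reducedNames fun _ _ => X.reducedNames_eq_of_glue) h

/-! ### Parametrized edges of a realization -/

section Realization

variable [AddCommGroup F] (Φ : V → F)

/-- The vector from the origin to the terminus of an edge of a realization. -/
def edgeVec (e : E) : F := Φ (X.t e) - Φ (X.o e)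

theorem edgeVec_inv (e : E) : X.edgeVec Φ (X.inv e) = -X.edgeVec Φ e := by
  simp [edgeVec, X.o_inv, X.t_inv]

variable [Module ℝ F]

/-- The point with parameter `s` on the edge `e` of a realization. -/
def edgePt (e : E) (s : ℝ) : F := Φ (X.o e) + s • X.edgeVec Φ e

@[simp] theorem edgePt_zero (e : E) : X.edgePt Φ e 0 = Φ (X.o e) := by simp [edgePt]

@[simp] theorem edgePt_one (e : E) : X.edgePt Φ e 1 = Φ (X.t e) := by simp [edgePt, edgeVec]

theorem plMap_inl (x : V) : X.plMap Φ (Quot.mk _ (Sum.inl x)) = Φ x := rfl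

theorem plMap_inr (e : E) (s : unitInterval) :
    X.plMap Φ (Quot.mk _ (Sum.inr (e, s))) = X.edgePt Φ e s := by
  change AffineMap.lineMap (Φ (X.o e)) (Φ (X.t e)) (s : ℝ) = _
  rw [AffineMap.lineMap_apply_module', add_comm]
  rfl

/-- The image of the cell complex under a realization, if every vertex lies on an edge. -/
theorem mem_range_plMap (hX : ∀ x, ∃ e, X.o e = x) (p : F) :
    p ∈ Set.range (X.plMap Φ) ↔ ∃ e, ∃ s ∈ Set.Icc (0 : ℝ) 1, X.edgePt Φ e s = p := by
  constructor
  · rintro ⟨⟨a⟩, rfl⟩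
    rcases a with x | ⟨e, s⟩
    · obtain ⟨e, rfl⟩ := hX x
      exact ⟨e, 0, by simp, by simp [X.plMap_inl]⟩
    · exact ⟨e, s, s.2, (X.plMap_inr Φ e s).symm⟩
  · rintro ⟨e, s, hs, rfl⟩
    exact ⟨Quot.mk _ (Sum.inr (e, ⟨s, hs⟩)), X.plMap_inr Φ e ⟨s, hs⟩⟩

/-! ### Consequences of injectivity on the cell complex -/

variable {X Φ}

theorem injective_of_injective_plMap (hinj : Function.Injective (X.plMap Φ))
    : Function.Injective Φ := by
  intro x y h
  have := X.reducedNames_eq_of_mk_eq (hinj (a₁ := Quot.mk _ (Sum.inl x))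
    (a₂ := Quot.mk _ (Sum.inl y)) h)
  simpa [reducedNames] using this

/-- Equal images come from equal points of the cell complex, and an interior point has only two
names: one on the edge and one on its reverse. -/
theorem eq_or_eq_inv_of_edgePt_eq (hinj : Function.Injective (X.plMap Φ))
    {e e' : E} {s s' : ℝ} (hs : s ∈ Set.Ioo (0 : ℝ) 1)
    (hs' : s' ∈ Set.Icc (0 : ℝ) 1) (h : X.edgePt Φ e s = X.edgePt Φ e' s') :
    (e' = e ∧ s' = s) ∨ (e' = X.inv e ∧ s' = 1 - s) := by
  have hI : s ∈ Set.Icc (0 : ℝ) 1 := ⟨hs.1.le, hs.2.le⟩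
  have key := X.reducedNames_eq_of_mk_eq (hinj (a₁ := Quot.mk _ (Sum.inr (e, ⟨s, hI⟩)))
    (a₂ := Quot.mk _ (Sum.inr (e', ⟨s', hs'⟩))) (by rw [plMap_inr, plMap_inr]; exact h))
  have h0 : (⟨s, hI⟩ : unitInterval) ≠ 0 := fun h => hs.1.ne' (congrArg Subtype.val h)
  have h1 : (⟨s, hI⟩ : unitInterval) ≠ 1 := fun h => hs.2.ne (congrArg Subtype.val h)
  have hmem : (Sum.inr (e, ⟨s, hI⟩) : V ⊕ E × unitInterval) ∈
      X.reducedNames (Sum.inr (e', ⟨s', hs'⟩)) := by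
    rw [← key]; simp [reducedNames, h0, h1]
  simp only [reducedNames] at hmem
  split_ifs at hmem
  · simp at hmem
  · simp at hmem
  · rcases hmem with hmem | hmem
    · simp only [Sum.inr.injEq, Prod.mk.injEq, Subtype.mk.injEq] at hmem
      exact Or.inl ⟨hmem.1.symm, hmem.2.symm⟩
    · simp only [Set.mem_singleton_iff, Sum.inr.injEq, Prod.mk.injEq] at hmem
      have h2 : s = 1 - s' := congrArg Subtype.val hmem.2
      exact Or.inr ⟨by rw [hmem.1, X.inv_inv], by linarith⟩

theorem edgeVec_ne_zero (hinj : Function.Injective (X.plMap Φ))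
    (e : E) : X.edgeVec Φ e ≠ 0 := by
  intro h
  -- A collapsed edge would identify the parameters 1/3 and 1/2. They are distinct and do not add up
  -- to 1, so the reversed edge does not explain this either.
  rcases eq_or_eq_inv_of_edgePt_eq hinj (e := e) (e' := e) (s := 1 / 3) (s' := 1 / 2)
    (by norm_num) (by norm_num) (by simp [edgePt, h]) with h | h
  · norm_num at h
  · norm_num at h

theorem eq_of_edgeVec_eq_smul (hinj : Function.Injective (X.plMap Φ))
    {e e' : E} (ho : X.o e' = X.o e) {c : ℝ} (hc : 0 < c)
    (h : X.edgeVec Φ e' = c • X.edgeVec Φ e) : e' = e := by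
  have hc' : 0 < 2 * (1 + c) := by positivity
  have e1 : c / (2 * (1 + c)) < 1 := by rw [div_lt_one hc']; linarith
  have e2 : 1 / (2 * (1 + c)) ≤ 1 := by rw [div_le_one hc']; linarith
  -- Both parameters give the displacement `c / (2 * (1 + c))` times the vector of `e`. Their sum is
  -- 1/2, which rules out the reversed edge.
  rcases eq_or_eq_inv_of_edgePt_eq hinj (e := e) (e' := e') (s := c / (2 * (1 + c)))
    (s' := 1 / (2 * (1 + c))) ⟨by positivity, e1⟩ ⟨by positivity, e2⟩
    (by simp only [edgePt, ho, h, smul_smul]; congr 2; field_simp) with h | h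
  · exact h.1
  · have := h.2
    field_simp at this
    linarith

theorem eq_of_origin_eq_of_edgeVec_eq (hinj : Function.Injective (X.plMap Φ))
    {e e' : E} (ho : Φ (X.o e') = Φ (X.o e))
    (h : X.edgeVec Φ e' = X.edgeVec Φ e) : e' = e :=
  eq_of_edgeVec_eq_smul hinj (injective_of_injective_plMap hinj ho) one_pos (by rw [h, one_smul])

/-- A vertex has parameter 0 on an edge that starts there, whereas every parameter of an interior
point lies strictly between 0 and 1. -/
theorem edgePt_eq_vertex (hinj : Function.Injective (X.plMap Φ))
    (hX : ∀ x, ∃ e, X.o e = x) {x : V} {e : E} {s : ℝ}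
    (hs : s ∈ Set.Icc (0 : ℝ) 1) (h : X.edgePt Φ e s = Φ x) :
    (s = 0 ∧ X.o e = x) ∨ (s = 1 ∧ X.t e = x) := by
  have hi := injective_of_injective_plMap hinj
  rcases eq_or_lt_of_le hs.1 with rfl | h0
  · exact Or.inl ⟨rfl, hi (by simpa using h)⟩
  rcases eq_or_lt_of_le hs.2 with rfl | h1
  · exact Or.inr ⟨rfl, hi (by simpa using h)⟩
  obtain ⟨f, rfl⟩ := hX x
  rcases eq_or_eq_inv_of_edgePt_eq hinj (e' := f) (s' := 0) ⟨h0, h1⟩ (by simp)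
    (by simpa using h) with h | h
  · linarith [h.2]
  · linarith [h.2]

end Realization

end DirGraph

end TopCrystal

namespace TopCrystal

namespace DirGraph

/-! ### Congruence transformations that preserve the image of a realization -/

section Isometry

variable {V E F : Type*} [NormedAddCommGroup F] [InnerProductSpace ℝ F]

/-- Every ball meets only finitely many edges. -/
def IsLocallyFinite (X : DirGraph V E) (Φ : V → F) : Prop :=
  ∀ (p : F) (r : ℝ), {e | ∃ s ∈ Set.Icc (0 : ℝ) 1, X.edgePt Φ e s ∈ Metric.closedBall p r}.Finite

/-- `S` contains a segment that starts at `p` in the direction of `w`. -/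
def IsTangent (S : Set F) (p w : F) : Prop :=
  ∃ ε > (0 : ℝ), ∀ s ∈ Set.Icc 0 ε, p + s • w ∈ S

variable {X : DirGraph V E} {Φ : V → F}

theorem isClosed_edge (e : E) : IsClosed (X.edgePt Φ e '' Set.Icc 0 1) :=
  (isCompact_Icc.image (by unfold edgePt; fun_prop)).isClosed

theorem isTangent_edgePt (hX : ∀ x, ∃ e, X.o e = x) (e : E) :
    IsTangent (Set.range (X.plMap Φ)) (Φ (X.o e)) (X.edgeVec Φ e) :=
  ⟨1, one_pos, fun s hs => (X.mem_range_plMap Φ hX _).2 ⟨e, s, hs, rfl⟩⟩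

theorem IsTangent.map {S : Set F} {p w : F} (h : IsTangent S p w) (g : F ≃ᵃⁱ[ℝ] F)
    (hg : g '' S = S) : IsTangent S (g p) (linearPart g w) := by
  obtain ⟨ε, hε, h⟩ := h
  refine ⟨ε, hε, fun s hs => ?_⟩
  rw [← hg]
  refine ⟨_, h s hs, ?_⟩
  have := g.map_vadd p (s • w)
  simp only [vadd_eq_add, map_smul] at this
  rw [add_comm p, this, add_comm]
  rfl

/-- A tangent vector lies along an edge through the base point. -/
theorem exists_edge_of_isTangent (hX : ∀ x, ∃ e, X.o e = x) (hlf : X.IsLocallyFinite Φ)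
    {p w : F} (h : IsTangent (Set.range (X.plMap Φ)) p w) :
    ∃ e, ∃ s ∈ Set.Icc (0 : ℝ) 1, ∃ s' ∈ Set.Icc (0 : ℝ) 1, ∃ a > (0 : ℝ),
      X.edgePt Φ e s = p ∧ X.edgePt Φ e s' = p + a • w := by
  obtain ⟨ε, hε, h⟩ := h
  let a : ℕ → ℝ := fun n => ε * (1 / ((n : ℝ) + 1))
  have ha0 : ∀ n, 0 < a n := fun n => by positivity
  have ha1 : ∀ n, a n ≤ ε := fun n => by
    have : 1 / ((n : ℝ) + 1) ≤ 1 := by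
      rw [div_le_one (by positivity)]
      linarith [(Nat.cast_nonneg n : (0 : ℝ) ≤ n)]
    nlinarith
  choose e s hs hes using fun n => (X.mem_range_plMap Φ hX _).1 (h (a n) ⟨(ha0 n).le, ha1 n⟩)
  have hmem : ∀ n, e n ∈
      {e | ∃ s ∈ Set.Icc (0 : ℝ) 1, X.edgePt Φ e s ∈ Metric.closedBall p (ε * ‖w‖)} := by
    intro n
    refine ⟨s n, hs n, ?_⟩
    rw [hes, Metric.mem_closedBall, dist_eq_norm, add_sub_cancel_left, norm_smul,
      Real.norm_of_nonneg (ha0 n).le]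
    exact mul_le_mul_of_nonneg_right (ha1 n) (norm_nonneg _)
  have : Finite {e | ∃ s ∈ Set.Icc (0 : ℝ) 1,
    X.edgePt Φ e s ∈ Metric.closedBall p (ε * ‖w‖)} := (hlf p (ε * ‖w‖)).to_subtype
  -- By pigeonhole one edge `f` contains infinitely many of the points `p + a n • w`. It is closed,
  -- so it also contains their limit `p`.
  obtain ⟨⟨f, _⟩, hf⟩ := Finite.exists_infinite_fiber (fun n => (⟨e n, hmem n⟩ :
    {e | ∃ s ∈ Set.Icc (0 : ℝ) 1, X.edgePt Φ e s ∈ Metric.closedBall p (ε * ‖w‖)}))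
  have hfreq : ∃ᶠ n in Filter.atTop, p + a n • w ∈ X.edgePt Φ f '' Set.Icc 0 1 := by
    refine Filter.Frequently.mono (Nat.frequently_atTop_iff_infinite.2
      (Set.infinite_coe_iff.1 hf)) fun n hn => ?_
    have hn' : e n = f := congrArg Subtype.val hn
    exact ⟨s n, hs n, by rw [← hn', hes]⟩
  have hlim : Filter.Tendsto (fun n => p + a n • w) Filter.atTop (nhds p) := by
    have h1 : Filter.Tendsto a Filter.atTop (nhds 0) := by
      have := (tendsto_one_div_add_atTop_nhds_zero_nat (𝕜 := ℝ)).const_mul ε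
      rwa [mul_zero] at this
    simpa using (h1.smul_const w).const_add p
  obtain ⟨s₀, hs₀, h₀⟩ := (isClosed_edge f).mem_of_frequently_of_tendsto hfreq hlim
  obtain ⟨n, s₁, hs₁, h₁⟩ := hfreq.exists
  exact ⟨f, s₀, hs₀, s₁, hs₁, a n, ha0 n, h₀, h₁⟩

theorem eq_smul_of_edgePt_eq {e : E} {s s' a : ℝ} {p w : F} (ha : 0 < a)
    (h : X.edgePt Φ e s = p) (h' : X.edgePt Φ e s' = p + a • w) :
    w = ((s' - s) / a) • X.edgeVec Φ e := by
  have h1 : a • w = (s' - s) • X.edgeVec Φ e := by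
    rw [← h] at h'
    simp only [edgePt] at h'
    rw [← add_right_inj (Φ (X.o e) + s • X.edgeVec Φ e), ← h']
    module
  rw [div_eq_inv_mul, mul_smul, ← h1, smul_smul, inv_mul_cancel₀ ha.ne', one_smul]

/-- No edge passes through a vertex, so the edge along the tangent has the vertex as an endpoint; if
it is the terminus, the reversed edge serves. -/
theorem exists_edge_of_isTangent_vertex (hinj : Function.Injective (X.plMap Φ))
    (hX : ∀ x, ∃ e, X.o e = x) (hlf : X.IsLocallyFinite Φ) {x : V} {w : F} (hw : w ≠ 0)
    (h : IsTangent (Set.range (X.plMap Φ)) (Φ x) w) :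
    ∃ e, X.o e = x ∧ ∃ c > (0 : ℝ), w = c • X.edgeVec Φ e := by
  obtain ⟨e, s, hs, s', hs', a, ha, h1, h2⟩ := exists_edge_of_isTangent hX hlf h
  have h3 := eq_smul_of_edgePt_eq ha h1 h2
  have hne : s' ≠ s := by
    rintro rfl
    simp [hw] at h3
  rcases edgePt_eq_vertex hinj hX hs h1 with ⟨rfl, rfl⟩ | ⟨rfl, rfl⟩
  · exact ⟨e, rfl, _, div_pos (sub_pos.2 (lt_of_le_of_ne hs'.1 hne.symm)) ha, h3⟩
  · refine ⟨X.inv e, X.o_inv e, (1 - s') / a,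
      div_pos (sub_pos.2 (lt_of_le_of_ne hs'.2 hne)) ha, ?_⟩
    rw [h3, edgeVec_inv]
    module

/-- Only the edge itself and its reverse pass through an interior point. -/
theorem exists_eq_smul_of_isTangent_edgePt (hinj : Function.Injective (X.plMap Φ))
    (hX : ∀ x, ∃ e, X.o e = x) (hlf : X.IsLocallyFinite Φ) {e : E} {s : ℝ}
    (hs : s ∈ Set.Ioo (0 : ℝ) 1) {w : F}
    (h : IsTangent (Set.range (X.plMap Φ)) (X.edgePt Φ e s) w) :
    ∃ c : ℝ, w = c • X.edgeVec Φ e := by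
  obtain ⟨f, t, ht, t', ht', a, ha, h1, h2⟩ := exists_edge_of_isTangent hX hlf h
  have h3 := eq_smul_of_edgePt_eq ha h1 h2
  rcases eq_or_eq_inv_of_edgePt_eq hinj hs ht h1.symm with ⟨rfl, -⟩ | ⟨rfl, -⟩
  · exact ⟨_, h3⟩
  · refine ⟨-((t' - t) / a), ?_⟩
    rw [h3, edgeVec_inv]
    module

/-- Among three edges that start at a vertex some two are not parallel. -/
theorem not_forall_edgeVec_eq_smul (hinj : Function.Injective (X.plMap Φ)) {x : V}
    (hdeg : 3 ≤ X.degree x) (u : F) :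
    ¬ ∀ e, X.o e = x → ∃ c : ℝ, X.edgeVec Φ e = c • u := by
  intro h
  have : Finite {e : E // X.o e = x} := Nat.finite_of_card_ne_zero (by
    unfold degree at hdeg; omega)
  have := Fintype.ofFinite {e : E // X.o e = x}
  unfold degree at hdeg
  rw [Nat.card_eq_fintype_card] at hdeg
  obtain ⟨⟨e₁, h₁⟩, ⟨e₂, h₂⟩, ⟨e₃, h₃⟩, h12, h13, h23⟩ := Fintype.two_lt_card_iff.1 hdeg
  have key : ∀ {e f : E} {a b : ℝ}, X.o e = x → X.o f = x → X.edgeVec Φ e = a • u →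
      X.edgeVec Φ f = b • u → 0 < a * b → e = f := by
    intro e f a b he hf ha hb hab
    have hb0 : b ≠ 0 := right_ne_zero_of_mul hab.ne'
    refine eq_of_edgeVec_eq_smul hinj (he.trans hf.symm) (c := a / b) ?_ ?_
    · have : a / b = a * b / (b * b) := by field_simp
      rw [this]
      exact div_pos hab (mul_self_pos.2 hb0)
    · rw [ha, hb, smul_smul, div_mul_cancel₀ _ hb0]
  obtain ⟨a, ha⟩ := h e₁ h₁
  obtain ⟨b, hb⟩ := h e₂ h₂
  obtain ⟨c, hc⟩ := h e₃ h₃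
  have h0 : ∀ {e : E} {r : ℝ}, X.edgeVec Φ e = r • u → r ≠ 0 := by
    rintro e r he rfl
    exact edgeVec_ne_zero hinj e (by rw [he, zero_smul])
  -- Coefficients of equal sign would make two edges overlap, so any two have opposite signs. This
  -- is impossible for three real numbers.
  have hab : a * b < 0 := lt_of_le_of_ne (not_lt.1 fun hp =>
    h12 (Subtype.ext (key h₁ h₂ ha hb hp))) (mul_ne_zero (h0 ha) (h0 hb))
  have hac : a * c < 0 := lt_of_le_of_ne (not_lt.1 fun hp =>
    h13 (Subtype.ext (key h₁ h₃ ha hc hp))) (mul_ne_zero (h0 ha) (h0 hc))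
  have hbc : b * c < 0 := lt_of_le_of_ne (not_lt.1 fun hp =>
    h23 (Subtype.ext (key h₂ h₃ hb hc hp))) (mul_ne_zero (h0 hb) (h0 hc))
  have : 0 < (a * b) * (a * c) := mul_pos_of_neg_of_neg hab hac
  have h4 : (a * b) * (a * c) = (a * a) * (b * c) := by ring
  have := mul_nonneg_of_nonpos_of_nonpos hbc.le (neg_nonpos.2 (mul_self_nonneg a))
  nlinarith

theorem map_edgePt (g : F ≃ᵃⁱ[ℝ] F) (e : E) (s : ℝ) :
    g (X.edgePt Φ e s) = g (Φ (X.o e)) + s • linearPart g (X.edgeVec Φ e) := by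
  have := g.map_vadd (Φ (X.o e)) (s • X.edgeVec Φ e)
  simp only [vadd_eq_add, map_smul] at this
  rw [edgePt, add_comm, this, add_comm]
  rfl

theorem linearPart_inv_apply (g : F ≃ᵃⁱ[ℝ] F) (w : F) :
    linearPart g⁻¹ (linearPart g w) = w := by
  rw [map_inv]
  exact (linearPart g).symm_apply_apply w

theorem linearPart_apply_inv (g : F ≃ᵃⁱ[ℝ] F) (w : F) :
    linearPart g (linearPart g⁻¹ w) = w := by
  rw [map_inv]
  exact (linearPart g).apply_symm_apply w

theorem inv_apply_self (g : F ≃ᵃⁱ[ℝ] F) (p : F) : g⁻¹ (g p) = p := g.symm_apply_apply p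

theorem apply_inv_self (g : F ≃ᵃⁱ[ℝ] F) (p : F) : g (g⁻¹ p) = p := g.apply_symm_apply p

theorem image_inv_eq {S : Set F} {g : F ≃ᵃⁱ[ℝ] F} (hg : g '' S = S) :
    ⇑(g⁻¹ : F ≃ᵃⁱ[ℝ] F) '' S = S := by
  conv_lhs => rw [← hg]
  rw [Set.image_image]
  simp [inv_apply_self]

/-- A vertex is mapped to a vertex. -/
theorem exists_vertex_map (hinj : Function.Injective (X.plMap Φ)) (hdeg : ∀ x, 3 ≤ X.degree x)
    (hX : ∀ x, ∃ e, X.o e = x) (hlf : X.IsLocallyFinite Φ) {g : F ≃ᵃⁱ[ℝ] F}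
    (hg : g '' Set.range (X.plMap Φ) = Set.range (X.plMap Φ)) (x : V) :
    ∃ y, g (Φ x) = Φ y := by
  have hmem : g (Φ x) ∈ Set.range (X.plMap Φ) := by
    rw [← hg]
    exact ⟨Φ x, ⟨Quot.mk _ (Sum.inl x), X.plMap_inl Φ x⟩, rfl⟩
  obtain ⟨e, s, hs, hes⟩ := (X.mem_range_plMap Φ hX _).1 hmem
  rcases eq_or_lt_of_le hs.1 with rfl | h0
  · exact ⟨X.o e, by simpa using hes.symm⟩
  rcases eq_or_lt_of_le hs.2 with rfl | h1
  · exact ⟨X.t e, by simpa using hes.symm⟩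
  -- If the image of the vertex were interior to `e`, the images of all edges at `x` would be
  -- parallel to `e`.
  refine (not_forall_edgeVec_eq_smul hinj (hdeg x) (linearPart g⁻¹ (X.edgeVec Φ e)) ?_).elim
  rintro f rfl
  have ht := (isTangent_edgePt (Φ := Φ) hX f).map g hg
  rw [← hes] at ht
  obtain ⟨c, hc⟩ := exists_eq_smul_of_isTangent_edgePt hinj hX hlf ⟨h0, h1⟩ ht
  exact ⟨c, by rw [← map_smul, ← hc, linearPart_inv_apply]⟩

/-- A directed edge is mapped to a directed edge. -/
theorem exists_edge_map (hinj : Function.Injective (X.plMap Φ)) (hdeg : ∀ x, 3 ≤ X.degree x)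
    (hX : ∀ x, ∃ e, X.o e = x) (hlf : X.IsLocallyFinite Φ) {g : F ≃ᵃⁱ[ℝ] F}
    (hg : g '' Set.range (X.plMap Φ) = Set.range (X.plMap Φ)) (e : E) :
    ∃ f, Φ (X.o f) = g (Φ (X.o e)) ∧ X.edgeVec Φ f = linearPart g (X.edgeVec Φ e) := by
  obtain ⟨y, hy⟩ := exists_vertex_map hinj hdeg hX hlf hg (X.o e)
  have ht := (isTangent_edgePt (Φ := Φ) hX e).map g hg
  rw [hy] at ht
  have hne : linearPart g (X.edgeVec Φ e) ≠ 0 := fun h =>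
    edgeVec_ne_zero hinj e ((linearPart g).map_eq_zero_iff.1 h)
  obtain ⟨f, rfl, c, hc, hcf⟩ := exists_edge_of_isTangent_vertex hinj hX hlf hne ht
  refine ⟨f, hy.symm, ?_⟩
  -- If `c < 1`, the terminus of `e` is sent into the interior of `f`; if `c > 1`, the inverse of
  -- `g` sends the terminus of `f` into the interior of `e`. Both contradict that vertices go to
  -- vertices.
  suffices c = 1 by rw [hcf, this, one_smul]
  have hpt : ∀ s : ℝ, g (X.edgePt Φ e s) = X.edgePt Φ f (s * c) := fun s => by
    rw [map_edgePt, hcf, hy, edgePt, smul_smul]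
  rcases lt_trichotomy c 1 with h | h | h
  · obtain ⟨z, hz⟩ := exists_vertex_map hinj hdeg hX hlf hg (X.t e)
    rw [← X.edgePt_one Φ, hpt, one_mul] at hz
    rcases edgePt_eq_vertex hinj hX ⟨hc.le, h.le⟩ hz with h' | h' <;> linarith [h'.1]
  · exact h
  · obtain ⟨z, hz⟩ := exists_vertex_map hinj hdeg hX hlf (image_inv_eq hg) (X.t f)
    have h1 : X.edgePt Φ e c⁻¹ = Φ z := by
      rw [← hz, ← X.edgePt_one Φ, ← inv_apply_self g (X.edgePt Φ e c⁻¹), hpt,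
        inv_mul_cancel₀ hc.ne']
    have h2 : c⁻¹ < 1 := inv_lt_one_of_one_lt₀ h
    have h3 : 0 < c⁻¹ := inv_pos.2 hc
    rcases edgePt_eq_vertex hinj hX ⟨h3.le, h2.le⟩ h1 with h' | h' <;> linarith [h'.1]

end Isometry

end DirGraph

end TopCrystal

namespace TopCrystal

open DirGraph

/-! ### Topological crystals and their periodic realizations -/

section Crystal

variable {V E V₀ E₀ L : Type*} [AddCommGroup L] [AddAction L V] [AddAction L E] {d : ℕ}
  {X : DirGraph V E} {X₀ : DirGraph V₀ E₀} {pV : V → V₀} {pE : E → E₀}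

theorem exists_origin_eq {x : V} (h : 3 ≤ X.degree x) : ∃ e, X.o e = x := by
  have : Nonempty {e : E // X.o e = x} := by
    by_contra hne
    rw [not_nonempty_iff] at hne
    simp [degree] at h
  exact ⟨this.some.1, this.some.2⟩

namespace IsTopologicalCrystal

variable (hX : IsTopologicalCrystal d L X X₀ pV pE)
include hX

theorem exists_lift {x : V} {e₀ : E₀} (h : X₀.o e₀ = pV x) : ∃ e, X.o e = x ∧ pE e = e₀ :=
  (hX.lift_edge x e₀ h).exists

theorem edge_ext {e f : E} (ho : X.o e = X.o f) (hp : pE e = pE f) : e = f :=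
  (hX.lift_edge (X.o f) (pE f) (hX.map_o f)).unique ⟨ho, hp⟩ ⟨rfl, rfl⟩

theorem surjective_edge : Function.Surjective pE := by
  intro e₀
  obtain ⟨x, hx⟩ := hX.surjective (X₀.o e₀)
  obtain ⟨e, -, he⟩ := hX.exists_lift hx.symm
  exact ⟨e, he⟩

theorem exists_vadd_vertex {x y : V} (h : pV x = pV y) : ∃ σ : L, σ +ᵥ x = y :=
  (hX.simply_transitive x y h).exists

theorem exists_vadd_edge {e f : E} (h : pE e = pE f) : ∃ σ : L, σ +ᵥ e = f := by
  obtain ⟨σ, hσ⟩ := hX.exists_vadd_vertex (x := X.o e) (y := X.o f)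
    (by rw [← hX.map_o, ← hX.map_o, h])
  exact ⟨σ, hX.edge_ext (by rw [hX.vadd_o, hσ]) (by rw [hX.map_vadd_edge, h])⟩

variable {Φ : V → EuclideanSpace ℝ (Fin d)} {ρ : L →+ EuclideanSpace ℝ (Fin d)}
  (hΦ : IsPeriodicRealization Φ ρ)
include hΦ

theorem edgeVec_vadd (σ : L) (e : E) : X.edgeVec Φ (σ +ᵥ e) = X.edgeVec Φ e := by
  simp [edgeVec, hX.vadd_o, hX.vadd_t, hΦ.equivariant]

theorem exists_isBuildingCochain :
    ∃ v : E₀ → EuclideanSpace ℝ (Fin d), IsBuildingCochain X pE Φ v := by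
  refine ⟨fun e₀ => X.edgeVec Φ (Function.surjInv hX.surjective_edge e₀), fun e => ?_⟩
  obtain ⟨σ, hσ⟩ := hX.exists_vadd_edge (f := e)
    (Function.surjInv_eq hX.surjective_edge (pE e))
  conv_rhs => rw [← edgeVec, ← hσ]
  exact (hX.edgeVec_vadd hΦ σ _).symm

omit hX [AddAction L E] in
theorem finite_period_norm_le (r : ℝ) : {σ : L | ‖ρ σ‖ ≤ r}.Finite := by
  have := hΦ.discrete
  have hc : IsClosed (ρ.range : Set (EuclideanSpace ℝ (Fin d))) := AddSubgroup.isClosed_of_discrete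
  have hf := Metric.finite_isBounded_inter_isClosed
    (isDiscrete_iff_discreteTopology.2 hΦ.discrete)
    (Metric.isBounded_closedBall (x := (0 : EuclideanSpace ℝ (Fin d))) (r := r)) hc
  refine (hf.preimage hΦ.injective.injOn).subset fun σ hσ => ?_
  exact ⟨by simpa using hσ, ⟨σ, rfl⟩⟩

/-- There are finitely many `L`-orbits of edges. Within an orbit, an edge that meets the ball
differs from a fixed lift by a period of bounded length, and discreteness leaves finitely many of
these. -/
theorem isLocallyFinite : X.IsLocallyFinite Φ := by
  intro p r
  have := hX.finite_edges
  let l : E₀ → E := Function.surjInv hX.surjective_edge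
  have hl : ∀ e₀, pE (l e₀) = e₀ := Function.surjInv_eq hX.surjective_edge
  refine (Set.finite_iUnion fun e₀ : E₀ => (finite_period_norm_le hΦ
    (r + ‖p‖ + ‖Φ (X.o (l e₀))‖ + ‖X.edgeVec Φ (l e₀)‖)).image fun σ => σ +ᵥ l e₀).subset ?_
  rintro e ⟨s, hs, he⟩
  obtain ⟨σ, hσ⟩ := hX.exists_vadd_edge (hl (pE e))
  generalize pE e = e₀ at hσ
  subst hσ
  refine Set.mem_iUnion.2 ⟨_, σ, ?_, rfl⟩
  simp only [edgePt, hX.vadd_o, hΦ.equivariant, hX.edgeVec_vadd hΦ, Metric.mem_closedBall,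
    dist_eq_norm] at he
  change ‖ρ σ‖ ≤ _
  set a := Φ (X.o (l e₀))
  set w := X.edgeVec Φ (l e₀)
  have h1 : ρ σ = (a + ρ σ + s • w - p) + p - a - s • w := by abel
  have h2 : ‖s • w‖ ≤ ‖w‖ := by
    rw [norm_smul, Real.norm_of_nonneg hs.1]
    exact mul_le_of_le_one_left (norm_nonneg _) hs.2
  calc ‖ρ σ‖ ≤ ‖a + ρ σ + s • w - p‖ + ‖p‖ + ‖a‖ + ‖s • w‖ := by
        conv_lhs => rw [h1]
        exact (norm_sub_le _ _).trans (add_le_add_left ((norm_sub_le _ _).trans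
          (add_le_add_left (norm_add_le _ _) _)) _)
    _ ≤ r + ‖p‖ + ‖a‖ + ‖w‖ := by gcongr

end IsTopologicalCrystal

end Crystal

/-! ### Harmonicity -/

section Harmonic

variable {V E V₀ E₀ L : Type*} [AddCommGroup L] [AddAction L V] [AddAction L E] {d : ℕ}
  {X : DirGraph V E} {X₀ : DirGraph V₀ E₀} {pV : V → V₀} {pE : E → E₀}
  {Φ : V → EuclideanSpace ℝ (Fin d)} {v : E₀ → EuclideanSpace ℝ (Fin d)}

/-- The sum over the edges at a vertex is fixed by the isotropy group. -/
theorem isHarmonic_of_isotropyGroup [Fintype E₀]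
    (hX : IsTopologicalCrystal d L X X₀ pV pE) (hinj : Function.Injective (X.plMap Φ))
    (hv : IsBuildingCochain X pE Φ v)
    {Γ : Subgroup (EuclideanSpace ℝ (Fin d) ≃ᵃⁱ[ℝ] EuclideanSpace ℝ (Fin d))}
    (hedge : ∀ g ∈ Γ, ∀ e, ∃ f, Φ (X.o f) = g (Φ (X.o e)) ∧
      X.edgeVec Φ f = linearPart g (X.edgeVec Φ e))
    (hfix : ∀ x : V, {w : EuclideanSpace ℝ (Fin d) |
      ∀ g ∈ isotropyGroup Γ (Φ x), linearPart g w = w} = {0}) :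
    IsHarmonic X₀ v := by
  classical
  intro x₀
  obtain ⟨x, rfl⟩ := hX.surjective x₀
  have hv' : ∀ e, v (pE e) = X.edgeVec Φ e := hv
  -- Edges at one vertex have distinct vectors by injectivity, so the sum runs over the finite set
  -- `D` of these vectors, which the isotropy group permutes.
  have hvinj : Set.InjOn v (Finset.univ.filter fun e₀ => X₀.o e₀ = pV x) := by
    intro a ha b hb hab
    simp only [Finset.coe_filter, Finset.mem_univ, true_and, Set.mem_ofPred_eq] at ha hb
    obtain ⟨e, he, rfl⟩ := hX.exists_lift ha
    obtain ⟨f, hf, rfl⟩ := hX.exists_lift hb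
    rw [eq_of_origin_eq_of_edgeVec_eq hinj (e := f) (e' := e) (by rw [he, hf])
      (by rw [← hv', ← hv', hab])]
  set D := (Finset.univ.filter fun e₀ => X₀.o e₀ = pV x).image v with hD
  have hsum : ∑ e₀ with X₀.o e₀ = pV x, v e₀ = ∑ w ∈ D, w :=
    (Finset.sum_image (f := fun w => w) hvinj).symm
  have hmem : ∑ e₀ with X₀.o e₀ = pV x, v e₀ ∈ {w : EuclideanSpace ℝ (Fin d) |
      ∀ g ∈ isotropyGroup Γ (Φ x), linearPart g w = w} := by
    rintro g ⟨hg, hgx⟩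
    have himg : D.image (linearPart g) = D := by
      refine Finset.eq_of_subset_of_card_le ?_
        (Finset.card_image_of_injective _ (linearPart g).injective).ge
      intro w hw
      simp only [hD, Finset.mem_image, Finset.mem_filter, Finset.mem_univ, true_and] at hw ⊢
      obtain ⟨_, ⟨e₀, h₀, rfl⟩, rfl⟩ := hw
      obtain ⟨e, he, rfl⟩ := hX.exists_lift h₀
      obtain ⟨f, hf, hfe⟩ := hedge g hg e
      rw [he, hgx] at hf
      refine ⟨pE f, ?_, by rw [hv', hv', hfe]⟩
      rw [hX.map_o, injective_of_injective_plMap hinj hf]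
    rw [hsum, map_sum]
    conv_rhs => rw [← himg]
    exact (Finset.sum_image (f := fun w => w) (linearPart g).injective.injOn).symm
  rw [hfix x, Set.mem_singleton_iff] at hmem
  convert hmem

end Harmonic

end TopCrystal

namespace TopCrystal

open DirGraph

/-! ### The frame operator -/

section Frame

variable {d : ℕ}

/-- The vectors of the translations that belong to a group of congruence transformations. -/
def translationVectors {F : Type*} [NormedAddCommGroup F] [InnerProductSpace ℝ F]
    (Γ : Subgroup (F ≃ᵃⁱ[ℝ] F)) : AddSubgroup F where
  carrier := {τ | AffineIsometryEquiv.constVAdd ℝ F τ ∈ Γ}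
  zero_mem' := by
    have : AffineIsometryEquiv.constVAdd ℝ F (0 : F) = 1 := AffineIsometryEquiv.constVAdd_zero ..
    simp [this, Γ.one_mem]
  add_mem' := by
    intro a b ha hb
    have : AffineIsometryEquiv.constVAdd ℝ F (a + b) =
        AffineIsometryEquiv.constVAdd ℝ F a * AffineIsometryEquiv.constVAdd ℝ F b := by
      ext p
      exact add_vadd a b p
    change _ ∈ Γ
    rw [this]
    exact Γ.mul_mem ha hb
  neg_mem' := by
    intro a ha
    have : AffineIsometryEquiv.constVAdd ℝ F (-a) = (AffineIsometryEquiv.constVAdd ℝ F a)⁻¹ := by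
      ext p
      rfl
    change _ ∈ Γ
    rw [this]
    exact Γ.inv_mem ha

/-- The point group preserves the vectors of translations. -/
theorem linearPart_mem_translationVectors {F : Type*} [NormedAddCommGroup F]
    [InnerProductSpace ℝ F] {Γ : Subgroup (F ≃ᵃⁱ[ℝ] F)} {g : F ≃ᵃⁱ[ℝ] F} (hg : g ∈ Γ) {τ : F}
    (hτ : τ ∈ translationVectors Γ) : linearPart g τ ∈ translationVectors Γ := by
  have : AffineIsometryEquiv.constVAdd ℝ F (linearPart g τ) =
      g * AffineIsometryEquiv.constVAdd ℝ F τ * g⁻¹ := by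
    ext p
    change linearPart g τ +ᵥ p = g (τ +ᵥ g⁻¹ p)
    rw [g.map_vadd, apply_inv_self]
    rfl
  change _ ∈ Γ
  rw [this]
  exact Γ.mul_mem (Γ.mul_mem hg hτ) (Γ.inv_mem hg)

/-- Both ranges are quotients by the same kernel relation; no finiteness is needed. -/
theorem card_range_eq_of_ker_eq {α β γ : Type*} {f : α → β} {h : α → γ}
    (hfh : ∀ a b, f a = f b ↔ h a = h b) : Nat.card (Set.range f) = Nat.card (Set.range h) := by
  have : Setoid.ker f = Setoid.ker h := Setoid.ext hfh
  exact Nat.card_congr ((Setoid.quotientKerEquivRange f).symm.trans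
    ((Quotient.congrRight fun a b => hfh a b).trans (Setoid.quotientKerEquivRange h)))

/-- A finite relation with the same positive number of partners on both sides transports sums. -/
theorem sum_eq_sum_of_relation {ι M : Type*} [Fintype ι] [AddCommGroup M] [Module ℝ M]
    (R : ι → ι → Prop) {k : ℕ} (hk : k ≠ 0) (hl : ∀ a, Nat.card {b | R a b} = k)
    (hr : ∀ b, Nat.card {a | R a b} = k) {p q : ι → M} (hpq : ∀ a b, R a b → p a = q b) :
    ∑ a, p a = ∑ b, q b := by
  classical
  -- Double counting: the sum over related pairs is evaluated by rows and by columns.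
  have h1 : ∑ a, ∑ b, (if R a b then p a else 0) = k • ∑ a, p a := by
    rw [Finset.smul_sum]
    refine Finset.sum_congr rfl fun a _ => ?_
    rw [← Finset.sum_filter, Finset.sum_const, ← hl a, Nat.card_eq_fintype_card,
      ← Set.toFinset_card]
    congr 2
    ext b; simp
  have h2 : ∑ a, ∑ b, (if R a b then p a else 0) = k • ∑ b, q b := by
    rw [Finset.sum_comm, Finset.smul_sum]
    refine Finset.sum_congr rfl fun b _ => ?_
    have : ∀ a, (if R a b then p a else 0) = if R a b then q b else 0 := fun a => by
      split_ifs with h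
      · exact hpq a b h
      · rfl
    simp only [this]
    rw [← Finset.sum_filter, Finset.sum_const, ← hr b, Nat.card_eq_fintype_card,
      ← Set.toFinset_card]
    congr 2
    ext a; simp
  have h3 : (k : ℝ) • ∑ a, p a = (k : ℝ) • ∑ b, q b := by
    rw [Nat.cast_smul_eq_nsmul, Nat.cast_smul_eq_nsmul, ← h1, h2]
  exact smul_right_injective M (Nat.cast_ne_zero.2 hk) h3

/-- The operator `x ↦ ∑ ⟨x, vᵢ⟩ vᵢ` of a finite family of vectors. -/
noncomputable def frameOperator {I F : Type*} [Fintype I] [NormedAddCommGroup F]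
    [InnerProductSpace ℝ F] (v : I → F) : F →ₗ[ℝ] F :=
  ∑ i, (innerₛₗ ℝ (v i)).smulRight (v i)

theorem frameOperator_apply {I F : Type*} [Fintype I] [NormedAddCommGroup F]
    [InnerProductSpace ℝ F] (v : I → F) (x : F) :
    frameOperator v x = ∑ i, inner ℝ x (v i) • v i := by
  simp [frameOperator, LinearMap.sum_apply, real_inner_comm]

theorem inner_frameOperator {I F : Type*} [Fintype I] [NormedAddCommGroup F]
    [InnerProductSpace ℝ F] (v : I → F) (x y : F) :
    inner ℝ (frameOperator v x) y = ∑ i, inner ℝ x (v i) * inner ℝ y (v i) := by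
  rw [frameOperator_apply, sum_inner]
  exact Finset.sum_congr rfl fun i _ => by rw [real_inner_smul_left, real_inner_comm y]

/-- A generating family of vectors whose frame operator commutes with an irreducible group is a
tight frame. -/
theorem isTightFrame_of_irreducible {I : Type*} [Fintype I] {v : I → EuclideanSpace ℝ (Fin d)}
    (hspan : Submodule.span ℝ (Set.range v) = ⊤)
    {K : Subgroup (EuclideanSpace ℝ (Fin d) ≃ₗᵢ[ℝ] EuclideanSpace ℝ (Fin d))}
    (hK : ActsIrreducibly K)
    (hcomm : ∀ g ∈ K, ∀ x, frameOperator v (g x) = g (frameOperator v x)) : IsTightFrame v := by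
  obtain ⟨hnt, hirr⟩ := hK
  have hsymm : (frameOperator v).IsSymmetric := fun x y => by
    rw [inner_frameOperator, real_inner_comm, inner_frameOperator]
    exact Finset.sum_congr rfl fun i _ => mul_comm _ _
  obtain ⟨α, hα⟩ : ∃ α : ℝ, Module.End.HasEigenvalue (frameOperator v) α :=
    ⟨_, hsymm.hasEigenvalue_iSup_of_finiteDimensional⟩
  have htop : Module.End.eigenspace (frameOperator v) α = ⊤ := by
    refine (hirr _ fun g hg w hw => ?_).resolve_left hα
    rw [Module.End.mem_eigenspace_iff] at hw ⊢
    rw [hcomm g hg, hw, map_smul]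
  have hall : ∀ x, frameOperator v x = α • x := fun x =>
    Module.End.mem_eigenspace_iff.1 (htop ▸ Submodule.mem_top)
  have hsq : ∀ x, ∑ i, inner ℝ x (v i) * inner ℝ x (v i) = α * (‖x‖ * ‖x‖) := fun x => by
    rw [← inner_frameOperator, hall, real_inner_smul_left, real_inner_self_eq_norm_mul_norm]
  obtain ⟨i, hi⟩ : ∃ i, v i ≠ 0 := by
    by_contra! h
    have hle : Submodule.span ℝ (Set.range v) ≤ ⊥ :=
      Submodule.span_le.2 (by rintro _ ⟨i, rfl⟩; simp [h i])
    rw [hspan] at hle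
    exact bot_ne_top (top_le_iff.1 hle)
  refine ⟨hspan, α, ?_, fun x => by rw [← frameOperator_apply, hall]⟩
  have hn : 0 < ‖v i‖ * ‖v i‖ := mul_self_pos.2 (norm_ne_zero_iff.2 hi)
  -- The identity `hsq` is tested on the nonzero vector `v i`, whose own term is already positive.
  have hpos : 0 < ∑ j, inner ℝ (v i) (v j) * inner ℝ (v i) (v j) := by
    refine Finset.sum_pos' (fun j _ => mul_self_nonneg _) ⟨i, Finset.mem_univ i, ?_⟩
    rw [real_inner_self_eq_norm_mul_norm]
    exact mul_self_pos.2 hn.ne'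
  rw [hsq] at hpos
  exact pos_of_mul_pos_left hpos hn.le

variable {V E V₀ E₀ L : Type*} [AddCommGroup L] [AddAction L V] [AddAction L E]
  {X : DirGraph V E} {X₀ : DirGraph V₀ E₀} {pV : V → V₀} {pE : E → E₀}
  {Φ : V → EuclideanSpace ℝ (Fin d)} {ρ : L →+ EuclideanSpace ℝ (Fin d)}
  {v : E₀ → EuclideanSpace ℝ (Fin d)}

/-- The building vectors generate the space. -/
theorem span_range_buildingCochain
    (hX : IsTopologicalCrystal d L X X₀ pV pE) (hΦ : IsPeriodicRealization Φ ρ)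
    (hv : IsBuildingCochain X pE Φ v) : Submodule.span ℝ (Set.range v) = ⊤ := by
  have hpath : ∀ x y : V, Φ y - Φ x ∈ Submodule.span ℝ (Set.range v) := by
    intro x y
    induction hX.connected.2 x y with
    | refl => simp
    | tail _ h ih =>
      obtain ⟨e, rfl, rfl⟩ := h
      have h1 : v (pE e) ∈ Submodule.span ℝ (Set.range v) :=
        Submodule.subset_span (Set.mem_range_self _)
      rw [hv e] at h1
      simpa using Submodule.add_mem _ ih h1
  rw [← top_le_iff, ← hΦ.span_eq_top, Submodule.span_le]
  rintro _ ⟨σ, rfl⟩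
  obtain ⟨x⟩ := hX.connected.1
  simpa [hΦ.equivariant] using hpath x (σ +ᵥ x)

/-! ### Invariance of sums over base edges under the point group -/

section Invariance

variable {Γ : Subgroup (EuclideanSpace ℝ (Fin d) ≃ᵃⁱ[ℝ] EuclideanSpace ℝ (Fin d))}

/-- The edges of the base graph that are covered by the translates of an edge. The period lattice
has finite index in the group of all translations, and this index is their number. -/
theorem card_translates (hX : IsTopologicalCrystal d L X X₀ pV pE)
    (hΦ : IsPeriodicRealization Φ ρ) (hinj : Function.Injective (X.plMap Φ))
    (hedge : ∀ g ∈ Γ, ∀ e, ∃ f, Φ (X.o f) = g (Φ (X.o e)) ∧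
      X.edgeVec Φ f = linearPart g (X.edgeVec Φ e))
    (e : E) :
    Nat.card {b | ∃ f, pE f = b ∧ Φ (X.o f) - Φ (X.o e) ∈ translationVectors Γ ∧
      X.edgeVec Φ f = X.edgeVec Φ e} =
      Nat.card (Set.range fun τ : translationVectors Γ =>
        QuotientAddGroup.mk (s := ρ.range) (τ : EuclideanSpace ℝ (Fin d))) := by
  have htr : ∀ τ : translationVectors Γ, ∃ f, Φ (X.o f) = Φ (X.o e) + τ ∧
      X.edgeVec Φ f = X.edgeVec Φ e := by
    rintro ⟨τ, hτ⟩
    obtain ⟨f, h1, h2⟩ := hedge _ hτ e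
    exact ⟨f, by rw [h1, add_comm]; rfl, h2⟩
  choose f hf hfe using htr
  have hrange : {b | ∃ f, pE f = b ∧ Φ (X.o f) - Φ (X.o e) ∈ translationVectors Γ ∧
      X.edgeVec Φ f = X.edgeVec Φ e} = Set.range fun τ => pE (f τ) := by
    ext b
    constructor
    · rintro ⟨f', rfl, h1, h2⟩
      refine ⟨⟨_, h1⟩, ?_⟩
      exact congrArg pE (eq_of_origin_eq_of_edgeVec_eq hinj (by rw [hf, add_sub_cancel])
        (by rw [hfe, h2]))
    · rintro ⟨τ, rfl⟩
      exact ⟨f τ, rfl, by rw [hf, add_sub_cancel_left]; exact τ.2, hfe τ⟩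
  rw [hrange]
  -- Two translates cover the same base edge exactly when `L` moves one to the other, which by
  -- injectivity means that their translation vectors differ by a period.
  refine card_range_eq_of_ker_eq fun a b => ?_
  rw [QuotientAddGroup.eq]
  constructor
  · intro h
    obtain ⟨σ, hσ⟩ := hX.exists_vadd_edge h
    refine ⟨σ, ?_⟩
    have h1 : Φ (X.o (f b)) = Φ (X.o (f a)) + ρ σ := by rw [← hσ, hX.vadd_o, hΦ.equivariant]
    rw [hf, hf, add_assoc, add_right_inj] at h1
    rw [h1]; abel
  · rintro ⟨σ, hσ⟩
    have h1 : f b = σ +ᵥ f a := by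
      refine eq_of_origin_eq_of_edgeVec_eq hinj ?_ (by rw [hX.edgeVec_vadd hΦ, hfe, hfe])
      rw [hX.vadd_o, hΦ.equivariant, hf, hf, hσ]; abel
    rw [h1, hX.map_vadd_edge]

/-- The lifts of `a` differ by periods, and `linearPart g` preserves the translation vectors of `Γ`.
All counted edges are therefore translates of a single image edge, so the count depends neither on
`g` nor on `a`. -/
theorem card_images (hX : IsTopologicalCrystal d L X X₀ pV pE)
    (hΦ : IsPeriodicRealization Φ ρ) (hinj : Function.Injective (X.plMap Φ))
    (hedge : ∀ g ∈ Γ, ∀ e, ∃ f, Φ (X.o f) = g (Φ (X.o e)) ∧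
      X.edgeVec Φ f = linearPart g (X.edgeVec Φ e))
    (hper : ∀ σ, ρ σ ∈ translationVectors Γ)
    {g : EuclideanSpace ℝ (Fin d) ≃ᵃⁱ[ℝ] EuclideanSpace ℝ (Fin d)} (hg : g ∈ Γ) (a : E₀) :
    Nat.card {b | ∃ e f, pE e = a ∧ pE f = b ∧
      Φ (X.o f) - g (Φ (X.o e)) ∈ translationVectors Γ ∧
      X.edgeVec Φ f = linearPart g (X.edgeVec Φ e)} =
      Nat.card (Set.range fun τ : translationVectors Γ =>
        QuotientAddGroup.mk (s := ρ.range) (τ : EuclideanSpace ℝ (Fin d))) := by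
  obtain ⟨e, rfl⟩ := hX.surjective_edge a
  obtain ⟨e', ho, he⟩ := hedge g hg e
  rw [← card_translates hX hΦ hinj hedge e']
  congr 1
  congr 1
  ext b
  constructor
  · rintro ⟨e₁, f, h1, rfl, h2, h3⟩
    obtain ⟨σ, rfl⟩ := hX.exists_vadd_edge h1.symm
    rw [hX.edgeVec_vadd hΦ] at h3
    refine ⟨f, rfl, ?_, h3.trans he.symm⟩
    have h4 : g (Φ (X.o (σ +ᵥ e))) = linearPart g (ρ σ) + g (Φ (X.o e)) := by
      rw [hX.vadd_o, hΦ.equivariant, add_comm]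
      exact g.map_vadd _ _
    have h5 : Φ (X.o f) - Φ (X.o e') =
        (Φ (X.o f) - g (Φ (X.o (σ +ᵥ e)))) + linearPart g (ρ σ) := by
      rw [h4, ho]; abel
    rw [h5]
    exact add_mem h2 (linearPart_mem_translationVectors hg (hper σ))
  · rintro ⟨f, rfl, h1, h2⟩
    exact ⟨e, f, rfl, rfl, by rwa [← ho], h2.trans he⟩

/-- Sums over the edges of the base graph are invariant under the point group. -/
theorem sum_building_comp_linearPart [Fintype E₀] (hX : IsTopologicalCrystal d L X X₀ pV pE)
    (hΦ : IsPeriodicRealization Φ ρ) (hinj : Function.Injective (X.plMap Φ))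
    (hv : IsBuildingCochain X pE Φ v)
    (hedge : ∀ g ∈ Γ, ∀ e, ∃ f, Φ (X.o f) = g (Φ (X.o e)) ∧
      X.edgeVec Φ f = linearPart g (X.edgeVec Φ e))
    (hper : ∀ σ, ρ σ ∈ translationVectors Γ)
    {g : EuclideanSpace ℝ (Fin d) ≃ᵃⁱ[ℝ] EuclideanSpace ℝ (Fin d)} (hg : g ∈ Γ)
    {M : Type*} [AddCommGroup M] [Module ℝ M] (q : EuclideanSpace ℝ (Fin d) → M) :
    ∑ a, q (linearPart g (v a)) = ∑ a, q (v a) := by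
  have hv' : ∀ e, v (pE e) = X.edgeVec Φ e := hv
  rcases isEmpty_or_nonempty E₀ with hE | ⟨⟨a₀⟩⟩
  · simp
  refine sum_eq_sum_of_relation (fun a b => ∃ e f, pE e = a ∧ pE f = b ∧
      Φ (X.o f) - g (Φ (X.o e)) ∈ translationVectors Γ ∧
      X.edgeVec Φ f = linearPart g (X.edgeVec Φ e)) (k := Nat.card (Set.range
        fun τ : translationVectors Γ =>
          QuotientAddGroup.mk (s := ρ.range) (τ : EuclideanSpace ℝ (Fin d)))) ?_
      (card_images hX hΦ hinj hedge hper hg) ?_ ?_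
  -- An infinite set would have `Nat.card` zero; here the set is finite because `E₀` is, and
  -- nonempty because an edge is its own translate.
  · obtain ⟨e, rfl⟩ := hX.surjective_edge a₀
    rw [← card_translates hX hΦ hinj hedge e]
    have : Nonempty {b | ∃ f, pE f = b ∧ Φ (X.o f) - Φ (X.o e) ∈ translationVectors Γ ∧
      X.edgeVec Φ f = X.edgeVec Φ e} := ⟨pE e, e, rfl, by simp [zero_mem], rfl⟩
    exact Nat.card_pos.ne'
  -- The partners on the other side are those of the relation for `g⁻¹`.
  · intro b
    rw [← card_images hX hΦ hinj hedge hper (Γ.inv_mem hg) b]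
    congr 1
    congr 1
    ext a
    constructor
    · rintro ⟨e, f, he, hf, h1, h2⟩
      refine ⟨f, e, hf, he, ?_, by rw [h2, linearPart_inv_apply]⟩
      have h3 : linearPart g⁻¹ (Φ (X.o f) - g (Φ (X.o e))) = g⁻¹ (Φ (X.o f)) - Φ (X.o e) := by
        conv_rhs => rw [← inv_apply_self g (Φ (X.o e))]
        exact g⁻¹.toAffineEquiv.toAffineMap.linearMap_vsub _ _
      rw [← neg_sub, ← h3]
      exact neg_mem (linearPart_mem_translationVectors (Γ.inv_mem hg) h1)
    · rintro ⟨f, e, hf, he, h1, h2⟩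
      refine ⟨e, f, he, hf, ?_, by rw [h2, linearPart_apply_inv]⟩
      have h3 : linearPart g (Φ (X.o e) - g⁻¹ (Φ (X.o f))) = g (Φ (X.o e)) - Φ (X.o f) := by
        conv_rhs => rw [← apply_inv_self g (Φ (X.o f))]
        exact g.toAffineEquiv.toAffineMap.linearMap_vsub _ _
      rw [← neg_sub, ← h3]
      exact neg_mem (linearPart_mem_translationVectors hg h1)
  · rintro _ _ ⟨e, f, rfl, rfl, -, h⟩
    rw [hv', hv', h]

theorem frameOperator_comm_linearPart [Fintype E₀] (hX : IsTopologicalCrystal d L X X₀ pV pE)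
    (hΦ : IsPeriodicRealization Φ ρ) (hinj : Function.Injective (X.plMap Φ))
    (hv : IsBuildingCochain X pE Φ v)
    (hedge : ∀ g ∈ Γ, ∀ e, ∃ f, Φ (X.o f) = g (Φ (X.o e)) ∧
      X.edgeVec Φ f = linearPart g (X.edgeVec Φ e))
    (hper : ∀ σ, ρ σ ∈ translationVectors Γ)
    {g : EuclideanSpace ℝ (Fin d) ≃ᵃⁱ[ℝ] EuclideanSpace ℝ (Fin d)} (hg : g ∈ Γ)
    (x : EuclideanSpace ℝ (Fin d)) :
    frameOperator v (linearPart g x) = linearPart g (frameOperator v x) := by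
  rw [frameOperator_apply, frameOperator_apply, map_sum,
    ← sum_building_comp_linearPart hX hΦ hinj hv hedge hper hg
      fun w => inner ℝ (linearPart g x) w • w]
  simp only [LinearIsometryEquiv.inner_map_map, map_smul]

end Invariance

end Frame

end TopCrystal

namespace TopCrystal

open DirGraph

/-! ### Chains and potentials -/

namespace DirGraph

variable {V E : Type*} {K : Type*} [CommRing K] {X : DirGraph V E}

theorem inv_injective (X : DirGraph V E) : Function.Injective X.inv :=
  Function.LeftInverse.injective X.inv_inv

theorem mem_chains_iff_mapDomain_inv {z : E →₀ K} :
    z ∈ X.chains K ↔ Finsupp.mapDomain X.inv z = -z := by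
  constructor
  · intro hz
    ext e
    rw [← X.inv_inv e, Finsupp.mapDomain_apply X.inv_injective, X.inv_inv, Finsupp.neg_apply]
    exact hz e
  · intro hz e
    have := DFunLike.congr_fun hz (X.inv e)
    rw [Finsupp.mapDomain_apply X.inv_injective, Finsupp.neg_apply] at this
    rw [this, neg_neg]

/-- The coboundary of a function on vertices vanishes on cycles. -/
theorem linearCombination_coboundary {M : Type*} [AddCommGroup M] [Module K M] (h : V → M)
    {z : X.chains K} (hz : z ∈ X.H1 K) :
    Finsupp.linearCombination K (fun e => h (X.t e) - h (X.o e)) z.1 = 0 := by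
  have ht : Finsupp.mapDomain X.t z.1 = 0 := hz
  -- Oddness turns the cycle condition at termini into the one at origins.
  have ho : Finsupp.mapDomain X.o z.1 = 0 := by
    have h1 : X.o = X.t ∘ X.inv := funext fun e => (X.t_inv e).symm
    rw [h1, Finsupp.mapDomain_comp, mem_chains_iff_mapDomain_inv.1 z.2]
    change Finsupp.mapDomain.addMonoidHom X.t (-z.1) = 0
    rw [map_neg, neg_eq_zero]
    exact ht
  have h1 := Finsupp.linearCombination_mapDomain (v' := h) K X.t z.1
  have h2 := Finsupp.linearCombination_mapDomain (v' := h) K X.o z.1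
  rw [ht, map_zero] at h1
  rw [ho, map_zero] at h2
  have h3 : Finsupp.linearCombination K (fun e => h (X.t e) - h (X.o e)) z.1 =
      Finsupp.linearCombination K (h ∘ X.t) z.1 - Finsupp.linearCombination K (h ∘ X.o) z.1 := by
    simp only [Finsupp.linearCombination_apply, Finsupp.sum, ← Finset.sum_sub_distrib, smul_sub,
      Function.comp_apply]
  rw [h3, ← h1, ← h2, sub_zero]

theorem exists_chain_boundary_eq (K : Type*) [CommRing K] (hX : X.Connected) (x y : V) :
    ∃ z : X.chains K, X.boundary K z = Finsupp.single y 1 - Finsupp.single x 1 := by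
  induction hX.2 x y with
  | refl => exact ⟨0, by simp⟩
  | tail _ h ih =>
    obtain ⟨e, rfl, rfl⟩ := h
    obtain ⟨z, hz⟩ := ih
    exact ⟨z + X.edgeChain K e, by rw [map_add, hz, boundary_edgeChain]; abel⟩

theorem inner_chains [Fintype E] (a b : X.chains ℝ) :
    inner ℝ a b = (1 / 2) * ∑ e, a.1 e * b.1 e := rfl

/-- A cycle that is the coboundary of a function on vertices vanishes. -/
theorem eq_zero_of_mem_H1_of_coboundary [Fintype E] {c : X.chains ℝ} (hc : c ∈ X.H1 ℝ) (h : V → ℝ)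
    (hh : ∀ e, c.1 e = h (X.t e) - h (X.o e)) : c = 0 := by
  -- The cycle is itself the coboundary, so this vanishing pairing is twice its squared norm.
  have h1 := linearCombination_coboundary h hc
  rw [Finsupp.linearCombination_apply, Finsupp.sum_fintype _ _ (by simp)] at h1
  rw [← inner_self_eq_zero (𝕜 := ℝ), inner_chains]
  simp only [smul_eq_mul, ← hh] at h1
  rw [h1, mul_zero]

theorem boundary_apply [Fintype E] [DecidableEq V] (c : X.chains ℝ) (x : V) :
    X.boundary ℝ c x = ∑ e with X.t e = x, c.1 e := by
  change Finsupp.mapDomain X.t c.1 x = _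
  rw [Finsupp.mapDomain, Finsupp.sum_apply, Finsupp.sum_fintype _ _ (by simp),
    Finset.sum_filter]
  exact Finset.sum_congr rfl fun e _ => Finsupp.single_apply

end DirGraph

/-! ### Standard realizations -/

section Standard

variable {V E V₀ E₀ L : Type*} [AddCommGroup L] [AddAction L V] [AddAction L E] {d : ℕ}
  {X : DirGraph V E} {X₀ : DirGraph V₀ E₀} {pV : V → V₀} {pE : E → E₀}
  {Φ : V → EuclideanSpace ℝ (Fin d)} {ρ : L →+ EuclideanSpace ℝ (Fin d)}
  {v : E₀ → EuclideanSpace ℝ (Fin d)}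

theorem mapDomain_mem_chains (hX : IsTopologicalCrystal d L X X₀ pV pE) (z : X.chains ℤ) :
    Finsupp.mapDomain pE z.1 ∈ X₀.chains ℤ := by
  have h : X₀.inv ∘ pE = pE ∘ X.inv := funext fun e => (hX.map_inv e).symm
  rw [mem_chains_iff_mapDomain_inv, ← Finsupp.mapDomain_comp, h, Finsupp.mapDomain_comp,
    mem_chains_iff_mapDomain_inv.1 z.2]
  exact map_neg (Finsupp.mapDomain.addMonoidHom pE) z.1

/-- A chain orthogonal to the vanishing subgroup lifts to the coboundary of a function on the
vertices of the crystal. -/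
theorem exists_potential [Fintype E₀] (hX : IsTopologicalCrystal d L X X₀ pV pE)
    {c : X₀.chains ℝ} (hc : c ∈ (vanishingSpace X X₀ pE)ᗮ) :
    ∃ f : V → ℝ, ∀ e, f (X.t e) - f (X.o e) = c.1 (pE e) := by
  -- `J` integrates the lift of `c`. It vanishes on cycles of `X`, because their images in `X₀` lie
  -- in the vanishing space.
  let J := Finsupp.linearCombination ℤ fun e => c.1 (pE e)
  have hJ : ∀ z ∈ X.H1 ℤ, J z.1 = 0 := by
    intro z hz
    let w : X₀.chains ℝ := ⟨Finsupp.equivFunOnFinite.symm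
      fun e₀ => ((Finsupp.mapDomain pE z.1 e₀ : ℤ) : ℝ), fun e₀ => by
        simp [mapDomain_mem_chains hX z e₀]⟩
    have hw : w ∈ vanishingSpace X X₀ pE := Submodule.subset_span ⟨z, hz, fun _ => rfl⟩
    have h1 := (Submodule.mem_orthogonal _ _).1 hc w hw
    have h2 : J z.1 = Finsupp.linearCombination ℤ c.1 (Finsupp.mapDomain pE z.1) :=
      (Finsupp.linearCombination_mapDomain (v' := c.1) ℤ pE z.1).symm
    rw [h2, Finsupp.linearCombination_apply, Finsupp.sum_fintype _ _ (by simp)]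
    rw [inner_chains] at h1
    simp only [zsmul_eq_mul]
    have h3 : ∑ e, w.1 e * c.1 e = 0 := by linarith
    exact h3
  obtain ⟨x₀⟩ := hX.connected.1
  choose z hz using exists_chain_boundary_eq ℤ hX.connected x₀
  -- Each edge occurs in a chain with both directions and is integrated twice, whence the half.
  refine ⟨fun x => J (z x).1 / 2, fun e => ?_⟩
  have h1 : z (X.t e) - z (X.o e) - X.edgeChain ℤ e ∈ X.H1 ℤ := by
    change X.boundary ℤ _ = 0
    rw [map_sub, map_sub, hz, hz, boundary_edgeChain]
    abel
  have h2 := hJ _ h1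
  have h3 : J (X.edgeChain ℤ e).1 = 2 * c.1 (pE e) := by
    simp only [J, edgeChain, map_sub, Finsupp.linearCombination_single, one_smul, hX.map_inv]
    rw [c.2 (pE e)]
    ring
  simp only [Submodule.coe_sub, map_sub, h3] at h2
  linarith

/-- Every real character of the period lattice is a linear functional. -/
theorem exists_inner_eq_character (hX : IsTopologicalCrystal d L X X₀ pV pE)
    (hΦ : IsPeriodicRealization Φ ρ) (χ : L →+ ℝ) : ∃ y, ∀ σ, inner ℝ y (ρ σ) = χ σ := by
  have := hX.free
  have := hX.finitely_generated
  let b := Module.finBasisOfFinrankEq ℤ L hX.rank_eq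
  have hspan : ⊤ ≤ Submodule.span ℝ (Set.range (ρ ∘ b)) := by
    rw [← hΦ.span_eq_top, Submodule.span_le]
    rintro _ ⟨σ, rfl⟩
    rw [← b.sum_repr σ, map_sum]
    refine Submodule.sum_mem _ fun i _ => ?_
    rw [map_zsmul, ← Int.cast_smul_eq_zsmul ℝ]
    exact Submodule.smul_mem _ _ (Submodule.subset_span ⟨i, rfl⟩)
  -- The rank of `L` equals the dimension, so the spanning images of a basis of `L` form a basis, on
  -- which a functional can be prescribed.
  have hli := linearIndependent_of_top_le_span_of_card_eq_finrank hspan (by simp)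
  let B := Module.Basis.mk hli hspan
  let φ : EuclideanSpace ℝ (Fin d) →ₗ[ℝ] ℝ := B.constr ℝ (χ ∘ b)
  have hφ : (φ.toAddMonoidHom.comp ρ).toIntLinearMap = χ.toIntLinearMap := by
    refine b.ext fun i => ?_
    change φ (ρ (b i)) = χ (b i)
    have hB : B i = ρ (b i) := Module.Basis.mk_apply hli hspan i
    rw [← hB, Module.Basis.constr_basis]
    rfl
  refine ⟨(InnerProductSpace.toDual ℝ _).symm (LinearMap.toContinuousLinearMap φ), fun σ => ?_⟩
  rw [InnerProductSpace.toDual_symm_apply]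
  exact LinearMap.congr_fun hφ σ

theorem buildingCochain_inv (hX : IsTopologicalCrystal d L X X₀ pV pE)
    (hv : IsBuildingCochain X pE Φ v) (e₀ : E₀) : v (X₀.inv e₀) = -v e₀ := by
  obtain ⟨e, rfl⟩ := hX.surjective_edge e₀
  rw [← hX.map_inv, hv, hv, X.o_inv, X.t_inv, neg_sub]

/-- The 1-chain `e ↦ ⟨y, v e⟩`, for an odd function `v` on directed edges. -/
noncomputable def pairingChain [Fintype E₀] (hodd : ∀ e₀, v (X₀.inv e₀) = -v e₀) :
    EuclideanSpace ℝ (Fin d) →ₗ[ℝ] X₀.chains ℝ where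
  toFun y := ⟨Finsupp.equivFunOnFinite.symm fun e₀ => inner ℝ y (v e₀), fun e₀ => by simp [hodd]⟩
  map_add' x y := by ext e₀; simp [inner_add_left]
  map_smul' r x := by ext e₀; simp [real_inner_smul_left]

theorem pairingChain_apply [Fintype E₀] (hodd : ∀ e₀, v (X₀.inv e₀) = -v e₀)
    (y : EuclideanSpace ℝ (Fin d)) (e₀ : E₀) :
    (pairingChain hodd y).1 e₀ = inner ℝ y (v e₀) := rfl

theorem pairingChain_mem_H1 [Fintype E₀] (hodd : ∀ e₀, v (X₀.inv e₀) = -v e₀)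
    (hharm : IsHarmonic X₀ v) (y : EuclideanSpace ℝ (Fin d)) : pairingChain hodd y ∈ X₀.H1 ℝ := by
  classical
  change X₀.boundary ℝ _ = 0
  ext x
  rw [boundary_apply]
  simp only [pairingChain_apply, ← inner_sum]
  have h1 : ∑ e with X₀.t e = x, v e = -∑ e with X₀.o e = x, v e := by
    rw [← Finset.sum_neg_distrib]
    refine Finset.sum_bij' (fun e _ => X₀.inv e) (fun e _ => X₀.inv e) ?_ ?_ ?_ ?_ ?_
    · intro e he; simpa [X₀.o_inv] using he
    · intro e he; simpa [X₀.t_inv] using he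
    · intro e _; exact X₀.inv_inv e
    · intro e _; exact X₀.inv_inv e
    · intro e _; rw [hodd, neg_neg]
  have h2 : ∑ e with X₀.o e = x, v e = 0 := by convert hharm x
  rw [h1, h2, neg_zero, inner_zero_right, Finsupp.zero_apply]

/-- Lifted to `X`, the chain is the coboundary of `⟨y, Φ⟩`, which vanishes on the cycles of `X`. -/
theorem pairingChain_mem_orthogonal [Fintype E₀] (hv : IsBuildingCochain X pE Φ v)
    (hodd : ∀ e₀, v (X₀.inv e₀) = -v e₀) (y : EuclideanSpace ℝ (Fin d)) :
    pairingChain hodd y ∈ (vanishingSpace X X₀ pE)ᗮ := by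
  refine (Submodule.mem_orthogonal _ _).2 fun u hu => ?_
  induction hu using Submodule.span_induction with
  | zero => exact inner_zero_left _
  | add a b _ _ ha hb => rw [inner_add_left, ha, hb, add_zero]
  | smul r a _ ha => rw [real_inner_smul_left, ha, mul_zero]
  | mem c hc =>
    obtain ⟨z, hz, hc⟩ := hc
    have h1 := linearCombination_coboundary (fun x => (inner ℝ y (Φ x) : ℝ)) hz
    have h2 := Finsupp.linearCombination_mapDomain (v' := fun e₀ => (inner ℝ y (v e₀) : ℝ)) ℤ
      pE z.1
    have h3 : (fun e₀ => (inner ℝ y (v e₀) : ℝ)) ∘ pE =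
        fun e => inner ℝ y (Φ (X.t e)) - inner ℝ y (Φ (X.o e)) :=
      funext fun e => by rw [Function.comp_apply, hv e, inner_sub_right]
    rw [h3, h1, Finsupp.linearCombination_apply, Finsupp.sum_fintype _ _ (by simp)] at h2
    simp only [zsmul_eq_mul, ← hc] at h2
    rw [inner_chains]
    simp only [pairingChain_apply, h2, mul_zero]

/-- The lift of `c` has a potential `f` whose increment under each `σ` is constant, since its
coboundary is `L`-invariant. The increments form a character `⟨y, ρ σ⟩`, so `f - ⟨y, Φ⟩` descends to
`X₀`. Thus `c` minus the chain of `y` is both a cycle and a coboundary on `X₀`, hence zero. -/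
theorem exists_pairingChain_eq [Fintype E₀] (hX : IsTopologicalCrystal d L X X₀ pV pE)
    (hΦ : IsPeriodicRealization Φ ρ) (hv : IsBuildingCochain X pE Φ v)
    (hodd : ∀ e₀, v (X₀.inv e₀) = -v e₀) (hharm : IsHarmonic X₀ v) {c : X₀.chains ℝ}
    (hc : c ∈ vanishingSpacePerp X X₀ pE) : ∃ y, pairingChain hodd y = c := by
  obtain ⟨f, hf⟩ := exists_potential hX hc.2
  have hconst : ∀ (σ : L) (x y : V), f (σ +ᵥ y) - f y = f (σ +ᵥ x) - f x := by
    intro σ x y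
    induction hX.connected.2 x y with
    | refl => rfl
    | tail _ h ih =>
      obtain ⟨e, rfl, rfl⟩ := h
      have h1 := hf (σ +ᵥ e)
      rw [hX.map_vadd_edge, ← hf e, hX.vadd_t, hX.vadd_o] at h1
      linarith
  obtain ⟨x₀⟩ := hX.connected.1
  let χ : L →+ ℝ :=
    { toFun := fun σ => f (σ +ᵥ x₀) - f x₀
      map_zero' := by simp
      map_add' := fun σ τ => by
        have := hconst σ x₀ (τ +ᵥ x₀)
        rw [add_vadd]
        linarith }
  obtain ⟨y, hy⟩ := exists_inner_eq_character hX hΦ χ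
  have hinv : ∀ (σ : L) (x : V),
      f (σ +ᵥ x) - inner ℝ y (Φ (σ +ᵥ x)) = f x - inner ℝ y (Φ x) := by
    intro σ x
    have h1 := hconst σ x₀ x
    have h2 : inner ℝ y (ρ σ) = f (σ +ᵥ x₀) - f x₀ := hy σ
    rw [hΦ.equivariant, inner_add_right]
    linarith
  let h : V₀ → ℝ := fun x => f (Function.surjInv hX.surjective x) -
    inner ℝ y (Φ (Function.surjInv hX.surjective x))
  have hh : ∀ x, h (pV x) = f x - inner ℝ y (Φ x) := by
    intro x
    obtain ⟨σ, hσ⟩ := hX.exists_vadd_vertex (y := x) (Function.surjInv_eq hX.surjective (pV x))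
    conv_rhs => rw [← hσ]
    exact (hinv σ _).symm
  refine ⟨y, (sub_eq_zero.1 (eq_zero_of_mem_H1_of_coboundary (c := c - pairingChain hodd y)
    (Submodule.sub_mem _ hc.1 (pairingChain_mem_H1 hodd hharm y)) h fun e₀ => ?_)).symm⟩
  obtain ⟨e, rfl⟩ := hX.surjective_edge e₀
  rw [hX.map_t, hX.map_o, hh, hh, Submodule.coe_sub, Finsupp.sub_apply, pairingChain_apply,
    ← hf e, hv e, inner_sub_right]
  ring

/-- A periodic realization with harmonic building vectors that form a tight frame is standard. -/
theorem isStandardRealization_of_isTightFrame [Fintype E₀]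
    (hX : IsTopologicalCrystal d L X X₀ pV pE) (hΦ : IsPeriodicRealization Φ ρ)
    (hv : IsBuildingCochain X pE Φ v) (hharm : IsHarmonic X₀ v) (htight : IsTightFrame v) :
    IsStandardRealization X X₀ pE Φ := by
  obtain ⟨-, α, hα, hframe⟩ := htight
  have hodd := buildingCochain_inv hX hv
  let T : EuclideanSpace ℝ (Fin d) →ₗ[ℝ] vanishingSpacePerp X X₀ pE :=
    (pairingChain hodd).codRestrict _ fun y =>
      ⟨pairingChain_mem_H1 hodd hharm y, pairingChain_mem_orthogonal hv hodd y⟩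
  -- Tightness gives `⟨T x, T y⟩ = (α / 2) ⟨x, y⟩`, the half coming from the inner product on
  -- chains; `s` rescales `T` to an isometry.
  set s : ℝ := √(2 / α) with hs
  have hs0 : 0 < s := Real.sqrt_pos.2 (by positivity)
  have hs2 : s * s = 2 / α := Real.mul_self_sqrt (by positivity)
  have hTinner : ∀ x y, inner ℝ ((s • T) x) ((s • T) y) = inner ℝ x y := by
    intro x y
    have h1 : inner ℝ (T x) (T y) = (1 / 2) * ∑ e, inner ℝ x (v e) * inner ℝ y (v e) := rfl
    rw [LinearMap.smul_apply, LinearMap.smul_apply, real_inner_smul_left, real_inner_smul_right,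
      h1, ← inner_frameOperator, frameOperator_apply, hframe, real_inner_smul_left]
    calc s * (s * (1 / 2 * (α * inner ℝ x y))) = (s * s) * α / 2 * inner ℝ x y := by ring
      _ = inner ℝ x y := by rw [hs2]; field_simp
  have hinj : Function.Injective (s • T) := by
    rw [injective_iff_map_eq_zero]
    intro x hx
    have := hTinner x x
    rw [hx, inner_zero_left] at this
    exact inner_self_eq_zero.1 this.symm
  have hsurj : Function.Surjective (s • T) := by
    rintro ⟨c, hc⟩
    obtain ⟨y, hy⟩ := exists_pairingChain_eq hX hΦ hv hodd hharm hc
    refine ⟨s⁻¹ • y, ?_⟩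
    rw [map_smul, LinearMap.smul_apply, smul_smul, inv_mul_cancel₀ hs0.ne', one_smul]
    exact Subtype.ext hy
  let S := (LinearEquiv.ofBijective (s • T) ⟨hinj, hsurj⟩).isometryOfInner hTinner
  have hS : ∀ y, S y = s • T y := fun y => rfl
  have hstd : ∀ e, S.symm (standardCochain X X₀ pE e) = s • v e := by
    intro e
    -- Against `S y`, which lies in both subspaces, the two projections can be dropped. What remains
    -- is the coefficient of `S y` at `e`.
    refine ext_inner_right ℝ fun y => ?_
    rw [← S.inner_map_map, S.apply_symm_apply, standardCochain,
      Submodule.inner_orthogonalProjectionOnto_eq_of_mem_right, harmonicEdge]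
    have h1 := Submodule.inner_orthogonalProjectionOnto_eq_of_mem_right
      (⟨(S y : X₀.chains ℝ), (S y).2.1⟩ : X₀.H1 ℝ) (X₀.edgeChain ℝ e)
    rw [Submodule.coe_inner] at h1
    rw [h1, inner_edgeChain_left, hS, real_inner_smul_left, real_inner_comm]
    rfl
  -- The normalized realization is `s • Φ`, and the similarity is scaling by `s⁻¹`.
  refine ⟨fun x => s • Φ x, ⟨S.symm, fun e => ?_⟩, s⁻¹, LinearIsometryEquiv.refl ℝ _, 0,
    inv_pos.2 hs0, fun x => ?_⟩
  · simp only [hstd, hv e, smul_sub]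
  · simp [smul_smul, hs0.ne']

end Standard

end TopCrystal

/-! ### Symmetric injective realizations are standard -/

theorem theorem7p3 {V E V₀ E₀ L : Type*} [Fintype E₀] [AddCommGroup L] [AddAction L V]
    [AddAction L E] {d : ℕ}
    -- a topological crystal `X` over `X₀`, all of whose degrees are at least three
    (X : TopCrystal.DirGraph V E) (X₀ : TopCrystal.DirGraph V₀ E₀) (pV : V → V₀) (pE : E → E₀)
    (hX : TopCrystal.IsTopologicalCrystal d L X X₀ pV pE)
    (hdeg : ∀ x : V, 3 ≤ X.degree x)
    -- an injective periodic realization `Φ` with period homomorphism `ρ`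
    (Φ : V → EuclideanSpace ℝ (Fin d)) (ρ : L →+ EuclideanSpace ℝ (Fin d))
    (hΦ : TopCrystal.IsPeriodicRealization Φ ρ)
    (hinj : Function.Injective (X.plMap Φ))
    -- a group `Γ` of congruence transformations that preserves the image of `Φ` and contains
    -- the period lattice
    (Γ : Subgroup (EuclideanSpace ℝ (Fin d) ≃ᵃⁱ[ℝ] EuclideanSpace ℝ (Fin d)))
    (hpres : ∀ g ∈ Γ, g '' Set.range (X.plMap Φ) = Set.range (X.plMap Φ))
    (hper : ∀ σ : L,
      AffineIsometryEquiv.constVAdd ℝ (EuclideanSpace ℝ (Fin d)) (ρ σ) ∈ Γ)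
    -- the point group acts irreducibly
    (hirr : TopCrystal.ActsIrreducibly (TopCrystal.pointGroup Γ))
    -- the isotropy group of each vertex, acting through linear parts, fixes only zero
    (hfix : ∀ x : V, {w : EuclideanSpace ℝ (Fin d) |
      ∀ g ∈ TopCrystal.isotropyGroup Γ (Φ x), TopCrystal.linearPart g w = w} = {0}) :
    TopCrystal.IsStandardRealization X X₀ pE Φ ∧
      ∃ v : E₀ → EuclideanSpace ℝ (Fin d), TopCrystal.IsBuildingCochain X pE Φ v ∧
        TopCrystal.IsTightFrame v ∧ TopCrystal.IsHarmonic X₀ v := by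
  have hV : ∀ x, ∃ e, X.o e = x := fun x => TopCrystal.exists_origin_eq (hdeg x)
  have hlf := hX.isLocallyFinite hΦ
  have hedge := fun g (hg : g ∈ Γ) => TopCrystal.DirGraph.exists_edge_map hinj hdeg hV hlf
    (hpres g hg)
  obtain ⟨v, hv⟩ := hX.exists_isBuildingCochain hΦ
  have hharm := TopCrystal.isHarmonic_of_isotropyGroup hX hinj hv hedge hfix
  have htight : TopCrystal.IsTightFrame v := by
    refine TopCrystal.isTightFrame_of_irreducible
      (TopCrystal.span_range_buildingCochain hX hΦ hv) hirr ?_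
    rintro _ ⟨g, hg, rfl⟩ x
    exact TopCrystal.frameOperator_comm_linearPart hX hΦ hinj hv hedge hper hg x
  exact ⟨TopCrystal.isStandardRealization_of_isTightFrame hX hΦ hv hharm htight,
    v, hv, htight, hharm⟩
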